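/- **Proposition (Generalized Stokes formulas of the second kind).** Let $\Sigma\subset\mathbb R^3$ be a compact embedded $C^2$ surface with (possibly empty) boundary curve $C=\partial\Sigma$ that is piecewise $C^1$ without cusps. Precisely: every point of $\Sigma$ has a relatively open neighbourhood in $\Sigma$ that is homeomorphically parametrized by $\{(x^1,x^2)\in U: x^2\ge h(x^1)\}$, where $U\subset\mathbb R^2$ is open, $h$ is Lipschitz and $C^1$ off a finite set, and the parametrization is $C^2$ on $U$ with linearly independent partial derivatives on $\{(x^1,x^2)\in U: x^2\ge h(x^1)\}$. The boundary $C$ corresponds to the points with $x^2=h(x^1)$. Let $\mathbf n$ be a continuous unit normal field on $\Sigma$, and let $\boldsymbol\tau$ be the unit tangent of $C$ (off the corners), oriented so that $\boldsymbol\tau\times\mathbf n$ points out of $\Sigma$. In local coordinates let $\mathbf g_i=\partial\boldsymbol\Sigma/\partial x^i$ be the covariant basis of the tangent plane, $g_{ij}=(\mathbf g_i,\mathbf g_j)$, $[g^{ij}]=[g_{ij}]^{-1}$, $\mathbf g^l=g^{lk}\mathbf g_k$ the dual basis, $b_{ij}=(\partial\mathbf g_i/\partial x^j,\mathbf n)$,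 and $H=g^{ij}b_{ij}$ the mean curvature. Let $\boldsymbol\Phi$ be a $C^1$ tensor field on $\Sigma$ (up to the boundary), of arbitrary order $p\ge 0$ over $\mathbb R^3$, and let $\circ$ be any bilinear tensor operation that combines a vector and a tensor of order $p$, in this order or in the opposite one, into a tensor of some order $q$ (for instance $\otimes$, $\cdot$ or $\times$). The surface gradient acts by $$\overset{\Sigma}{\nabla}\circ\boldsymbol\Phi=\mathbf g^l\circ\frac{\partial\boldsymbol\Phi}{\partial x^l},\qquad \boldsymbol\Phi\circ\overset{\Sigma}{\nabla}=\frac{\partial\boldsymbol\Phi}{\partial x^l}\circ\mathbf g^l .$$ Then, with $dl$ the arc length of $C$ and $d\sigma$ the area element of $\Sigma$, all integrands below are integrable and $$\oint_C(\boldsymbol\tau\times\mathbf n)\circ\boldsymbol\Phi\,dl=\int_\Sigma\left(\overset{\Sigma}{\nabla}\circ\boldsymbol\Phi+H\,\mathbf n\circ\boldsymbol\Phi\right)d\sigma,$$ $$\oint_C\boldsymbol\Phi\circ(\boldsymbol\tau\times\mathbf n)\,dl=\int_\Sigma\left(\boldsymbol\Phi\circ\overset{\Sigma}{\nabla}+H\,\boldsymbol\Phi\circ\mathbf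 n\right)d\sigma .$$ -/

import Mathlib

open MeasureTheory

/-- Euclidean three-space. -/
abbrev E3 : Type := EuclideanSpace ℝ (Fin 3)

/-- The vector (cross) product of Euclidean three-space. -/
noncomputable def cross (u v : E3) : E3 := WithLp.toLp 2 (crossProduct u.ofLp v.ofLp)

/-- Tensors of order `p` over Euclidean three-space, as `p`-linear forms (vectors and covectors are
identified by the inner product). -/
abbrev Tensor (p : ℕ) : Type := ContinuousMultilinearMap ℝ (fun _ : Fin p => E3) ℝ

/-- The two coordinate directions of the parameter plane. -/
def coordDir : Fin 2 → ℝ × ℝ := ![(1, 0), (0, 1)]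

/-- A local `C²` parametrization of the set `S ⊆ ℝ³`, as a surface with piecewise `C¹` boundary.
The parameter domain is the part of an open set `U` of the plane that lies on or above the graph of
a piecewise `C¹` Lipschitz function `h`. A chart around an interior point is the case where `U` lies
above the graph; smooth boundary points, convex corners and re-entrant corners are all covered. -/
structure LocalParam (S : Set E3) where
  /-- The parametrization (only its values on `U` matter). -/
  map : ℝ × ℝ → E3
  /-- The open set on which the parametrization is `C²`. -/
  U : Set (ℝ × ℝ)
  /-- The function whose graph is the boundary in the parameter plane. -/
  h : ℝ → ℝ
  /-- The finitely many places where the boundary may have a corner. -/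
  corners : Finset ℝ
  isOpen_U : IsOpen U
  lipschitz_h : ∃ K : NNReal, LipschitzWith K h
  contDiffOn_h : ContDiffOn ℝ 1 h (corners : Set ℝ)ᶜ
  contDiffOn_map : ContDiffOn ℝ 2 map U
  linearIndependent : ∀ x ∈ U, h x.1 ≤ x.2 →
    LinearIndependent ℝ (fun i : Fin 2 => fderiv ℝ map x (coordDir i))
  isEmbedding : Topology.IsEmbedding (Set.domRestrict {x | x ∈ U ∧ h x.1 ≤ x.2} map)
  image_open : ∃ W : Set E3, IsOpen W ∧ map '' {x | x ∈ U ∧ h x.1 ≤ x.2} = S ∩ W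

namespace LocalParam

variable {S : Set E3}

/-- The parameter domain. -/
def dom (c : LocalParam S) : Set (ℝ × ℝ) := {x | x ∈ c.U ∧ c.h x.1 ≤ x.2}

/-- The covariant basis `g_i = ∂Σ/∂x^i`. -/
noncomputable def g (c : LocalParam S) (i : Fin 2) (x : ℝ × ℝ) : E3 :=
  fderiv ℝ c.map x (coordDir i)

/-- The metric coefficients `g_{ij} = (g_i, g_j)`. -/
noncomputable def metric (c : LocalParam S) (x : ℝ × ℝ) : Matrix (Fin 2) (Fin 2) ℝ :=
  Matrix.of fun i j => inner ℝ (c.g i x) (c.g j x)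

/-- The contravariant (dual) basis `g^l = g^{lk} g_k` of the tangent plane. -/
noncomputable def gDual (c : LocalParam S) (l : Fin 2) (x : ℝ × ℝ) : E3 :=
  ∑ k, (c.metric x)⁻¹ l k • c.g k x

/-- The curvature coefficients `b_{ij} = (∂g_i/∂x^j, n)`. -/
noncomputable def curv (c : LocalParam S) (n : E3 → E3) (x : ℝ × ℝ) (i j : Fin 2) : ℝ :=
  inner ℝ (fderiv ℝ (c.g i) x (coordDir j)) (n (c.map x))

/-- The mean curvature `H = b^s_s = g^{ij} b_{ij}` (the trace, without a factor `1/2`). -/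
noncomputable def meanCurv (c : LocalParam S) (n : E3 → E3) (x : ℝ × ℝ) : ℝ :=
  ∑ i, ∑ j, (c.metric x)⁻¹ i j * c.curv n x i j

/-- The partial derivative `∂Φ/∂x^l` of a tensor field on the surface. -/
noncomputable def pderiv {p : ℕ} (c : LocalParam S) (Φ : E3 → Tensor p) (l : Fin 2)
    (x : ℝ × ℝ) : Tensor p :=
  fderivWithin ℝ (Φ ∘ c.map) c.dom x (coordDir l)

/-- The area element `√det(g_{ij}) dx¹dx²`, transported to the surface. -/
noncomputable def area (c : LocalParam S) : Measure E3 :=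
  Measure.map c.map ((volume.restrict c.dom).withDensity
    fun x => ENNReal.ofReal (Real.sqrt (c.metric x).det))

/-- The parametrized piece of boundary curve. -/
def edge (c : LocalParam S) (s : ℝ) : E3 := c.map (s, c.h s)

/-- The parameters of the boundary points, corners excluded. -/
def edgeDom (c : LocalParam S) : Set ℝ := {s | (s, c.h s) ∈ c.U ∧ s ∉ c.corners}

/-- The arc length element `|dΣ(s, h(s))/ds| ds`, transported to the boundary curve. -/
noncomputable def arcLength (c : LocalParam S) : Measure E3 :=
  Measure.map c.edge ((volume.restrict c.edgeDom).withDensity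
    fun s => ENNReal.ofReal ‖deriv c.edge s‖)

end LocalParam

/-- `S` is a compact (embedded) surface with (possibly empty) piecewise `C¹` boundary. -/
def IsCompactSurface (S : Set E3) : Prop :=
  IsCompact S ∧ ∀ p ∈ S, ∃ (c : LocalParam S), ∃ x ∈ c.dom, c.map x = p

/-- `n` is a continuous unit normal field on `S`, that is, an orientation of `S`. -/
def IsUnitNormal (S : Set E3) (n : E3 → E3) : Prop :=
  ContinuousOn n S ∧ ∀ (c : LocalParam S), ∀ x ∈ c.dom,
    ‖n (c.map x)‖ = 1 ∧ ∀ i, inner ℝ (n (c.map x)) (c.g i x) = 0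

/-- `τ` is the unit tangent of the boundary curve of `S`, positively oriented with respect to `n`:
`τ × n` points out of the surface. (In a chart, the second coordinate direction points into the
surface at the boundary.) Nothing is asked at the corners. -/
def IsPositiveTangent (S : Set E3) (n τ : E3 → E3) : Prop :=
  ∀ (c : LocalParam S), ∀ s ∈ c.edgeDom,
    ‖τ (c.edge s)‖ = 1 ∧ τ (c.edge s) ∈ Submodule.span ℝ {deriv c.edge s} ∧
      inner ℝ (cross (τ (c.edge s)) (n (c.edge s))) (c.g 1 (s, c.h s)) < 0

/-- A tensor field of order `p` on `S` that is continuously differentiable, up to the boundary. -/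
def IsC1Field {p : ℕ} (S : Set E3) (Φ : E3 → Tensor p) : Prop :=
  ∀ c : LocalParam S, ContDiffOn ℝ 1 (Φ ∘ c.map) c.dom

/-- The area measure `dσ` of `S`: the least measure above the area elements of all the local
parametrizations. As these agree on overlaps, it restricts to each of them on its patch. -/
noncomputable def areaMeasure (S : Set E3) : Measure E3 := ⨆ c : LocalParam S, c.area

/-- The arc length measure `dl` of the boundary curve of `S`, obtained in the same way. -/
noncomputable def boundaryMeasure (S : Set E3) : Measure E3 := ⨆ c : LocalParam S, c.arcLength

open Classical in
/-- The value at `p ∈ S` of a quantity that is computed in local coordinates; it is used only for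
quantities that do not depend on the parametrization. -/
noncomputable def atPoint {α : Type*} [Zero α] (S : Set E3) (F : LocalParam S → ℝ × ℝ → α)
    (p : E3) : α :=
  if hp : ∃ q : LocalParam S × (ℝ × ℝ), q.2 ∈ q.1.dom ∧ q.1.map q.2 = p then
    F hp.choose.1 hp.choose.2
  else 0

/-- The mean curvature of `S` with respect to the normal `n`. -/
noncomputable def meanCurvature (S : Set E3) (n : E3 → E3) : E3 → ℝ :=
  atPoint S fun c x => c.meanCurv n x

/-- The surface gradient acting from the left through the tensor operation `op`:
`g^l ∘ ∂Φ/∂x^l`. -/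
noncomputable def surfaceGradLeft {p q : ℕ} (S : Set E3)
    (op : E3 →L[ℝ] Tensor p →L[ℝ] Tensor q) (Φ : E3 → Tensor p) : E3 → Tensor q :=
  atPoint S fun c x => ∑ l, op (c.gDual l x) (c.pderiv Φ l x)

/-- The surface gradient acting from the right through the tensor operation `op`:
`∂Φ/∂x^l ∘ g^l`. -/
noncomputable def surfaceGradRight {p q : ℕ} (S : Set E3)
    (op : Tensor p →L[ℝ] E3 →L[ℝ] Tensor q) (Φ : E3 → Tensor p) : E3 → Tensor q :=
  atPoint S fun c x => ∑ l, op (c.pderiv Φ l x) (c.gDual l x)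

/-! In a chart, let `N` be the unit normal along `g₀ × g₁` and `J = |g₀ × g₁| = √det(g_ij)`. Then `J
g⁰ = g₁ × N` and `J g¹ = N × g₀`. In the planar divergence `∂₀(J g⁰) + ∂₁(J g¹)` the mixed second
derivatives of the parametrization cancel. What remains is `g₁ × ∂₀N + ∂₁N × g₀`, a multiple of `N`
because each `∂ᵢN` is tangent, and it equals `J H n` (`divergence_conormal`); the product `H n` is
insensitive to the sign relating `n` to `N`. By the product rule the planar divergence of the fields
`J gˡ ∘ Φ` is the surface integrand times `J` (`divergence_flux`).

The planar divergence theorem over `x² ≥ h(x¹)` (`integral_epi_divergence`) turns this into an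
integral of `(h' J g⁰ - J g¹) ∘ Φ` over the graph of `h`. That vector is `e × N`, with `e` the
velocity of the boundary curve, and the orientation of `τ` makes it `|e| τ × n`
(`norm_smul_cross_tangent`). This gives the formula for fields supported in one chart, and a
partition of unity gives it for all.

The global objects must not depend on the chart. Coordinate changes extend near each point, boundary
points included, to strictly differentiable maps with invertible derivative, so they preserve
interior and boundary. The contraction `gˡ ∘ ∂Φ/∂xˡ` is then invariant, `H` is such a contraction of
`n` up to sign, and the area and length elements agree on overlaps, so that their suprema restrict
to each of them on its patch. The second formula is the first one for the flipped operation. -/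

/-! ### Cross product identities in three-space. -/

theorem cross_apply_zero (u v : E3) : cross u v 0 = u 1 * v 2 - u 2 * v 1 := by
  simp [cross, cross_apply]

theorem cross_apply_one (u v : E3) : cross u v 1 = u 2 * v 0 - u 0 * v 2 := by
  simp [cross, cross_apply]

theorem cross_apply_two (u v : E3) : cross u v 2 = u 0 * v 1 - u 1 * v 0 := by
  simp [cross, cross_apply]

theorem inner_E3 (u v : E3) : inner ℝ u v = u 0 * v 0 + u 1 * v 1 + u 2 * v 2 := by
  simp [PiLp.inner_apply, Fin.sum_univ_three, mul_comm]

theorem E3_ext {u v : E3} (h0 : u 0 = v 0) (h1 : u 1 = v 1) (h2 : u 2 = v 2) : u = v := by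
  ext i; fin_cases i <;> assumption

/-- The cross product as a continuous bilinear map. -/
noncomputable def crossL : E3 →L[ℝ] E3 →L[ℝ] E3 :=
  LinearMap.toContinuousLinearMap
    ((LinearMap.toContinuousLinearMap : (E3 →ₗ[ℝ] E3) ≃ₗ[ℝ] (E3 →L[ℝ] E3)).toLinearMap ∘ₗ
      LinearMap.mk₂ ℝ cross
        (fun a b c => E3_ext (by simp only [PiLp.add_apply, cross_apply_zero]; ring)
          (by simp only [PiLp.add_apply, cross_apply_one]; ring)
          (by simp only [PiLp.add_apply, cross_apply_two]; ring))
        (fun r a b => E3_ext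
          (by simp only [PiLp.smul_apply, cross_apply_zero, smul_eq_mul]; ring)
          (by simp only [PiLp.smul_apply, cross_apply_one, smul_eq_mul]; ring)
          (by simp only [PiLp.smul_apply, cross_apply_two, smul_eq_mul]; ring))
        (fun a b c => E3_ext (by simp only [PiLp.add_apply, cross_apply_zero]; ring)
          (by simp only [PiLp.add_apply, cross_apply_one]; ring)
          (by simp only [PiLp.add_apply, cross_apply_two]; ring))
        (fun r a b => E3_ext
          (by simp only [PiLp.smul_apply, cross_apply_zero, smul_eq_mul]; ring)
          (by simp only [PiLp.smul_apply, cross_apply_one, smul_eq_mul]; ring)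
          (by simp only [PiLp.smul_apply, cross_apply_two, smul_eq_mul]; ring)))

theorem crossL_apply (u v : E3) : crossL u v = cross u v := rfl

theorem cross_swap (u v : E3) : cross u v = -cross v u :=
  E3_ext (by simp [cross_apply_zero, mul_comm]) (by simp [cross_apply_one, mul_comm])
    (by simp [cross_apply_two, mul_comm])

theorem cross_smul_right (r : ℝ) (u v : E3) : cross u (r • v) = r • cross u v :=
  (crossL u).map_smul r v

theorem cross_smul_left (r : ℝ) (u v : E3) : cross (r • u) v = r • cross u v := by
  simp [← crossL_apply]

theorem cross_add_left (u v w : E3) : cross (u + v) w = cross u w + cross v w := by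
  simp [← crossL_apply]

theorem inner_cross_left_self (u v : E3) : inner ℝ (cross u v) u = 0 := by
  simp only [inner_E3, cross_apply_zero, cross_apply_one, cross_apply_two]; ring

theorem inner_cross_right_self (u v : E3) : inner ℝ (cross u v) v = 0 := by
  simp only [inner_E3, cross_apply_zero, cross_apply_one, cross_apply_two]; ring

theorem inner_cross_perm (u v w : E3) : inner ℝ (cross u v) w = inner ℝ (cross v w) u := by
  simp only [inner_E3, cross_apply_zero, cross_apply_one, cross_apply_two]; ring

theorem cross_cross_right (u v w : E3) :
    cross u (cross v w) = inner ℝ u w • v - inner ℝ u v • w := by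
  apply E3_ext <;>
  simp only [inner_E3, cross_apply_zero, cross_apply_one, cross_apply_two, PiLp.sub_apply,
    PiLp.smul_apply, smul_eq_mul] <;> ring

theorem norm_cross_sq (u v : E3) :
    ‖cross u v‖ ^ 2 = inner ℝ u u * inner ℝ v v - inner ℝ u v * inner ℝ v u := by
  rw [← real_inner_self_eq_norm_sq]
  simp only [inner_E3, cross_apply_zero, cross_apply_one, cross_apply_two]; ring

theorem cross_ne_zero {g : Fin 2 → E3} (hg : LinearIndependent ℝ g) : cross (g 0) (g 1) ≠ 0 := by
  have h : LinearIndependent ℝ ![(g 0).ofLp, (g 1).ofLp] := by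
    have := hg.map' (WithLp.linearEquiv 2 ℝ (Fin 3 → ℝ)).toLinearMap (LinearEquiv.ker _)
    have e : ![(g 0).ofLp, (g 1).ofLp] = (WithLp.linearEquiv 2 ℝ (Fin 3 → ℝ)).toLinearMap ∘ g := by
      ext i; fin_cases i <;> rfl
    rw [e]
    exact this
  have := (crossProduct_ne_zero_iff_linearIndependent (F := ℝ)).2 h
  intro h0
  exact this (by simpa [cross] using h0)

/-- A vector normal to a plane is determined by its component along a unit normal. -/
theorem cross_eq_inner_smul {N a b : E3} (hN : ‖N‖ = 1) (ha : inner ℝ a N = 0)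
    (hb : inner ℝ b N = 0) : cross a b = (inner ℝ (cross a b) N : ℝ) • N := by
  have h1 : cross N (cross a b) = 0 := by
    rw [cross_cross_right, real_inner_comm, hb, real_inner_comm, ha]; simp
  have h2 := cross_cross_right N (cross a b) N
  rw [cross_swap (cross a b) N, h1, real_inner_self_eq_norm_sq, hN] at h2
  simp only [neg_zero] at h2
  have h3 : cross N (0 : E3) = 0 := (crossL N).map_zero
  rw [h3, real_inner_comm] at h2
  simpa using (sub_eq_zero.1 h2.symm)

/-! ### Gram matrix, dual basis and unit normal of two vectors. -/

/-- The Gram matrix of a pair of vectors. -/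
noncomputable def gram2 (g : Fin 2 → E3) : Matrix (Fin 2) (Fin 2) ℝ :=
  Matrix.of fun i j => inner ℝ (g i) (g j)

/-- The dual basis of a pair of vectors. -/
noncomputable def dual2 (g : Fin 2 → E3) (l : Fin 2) : E3 := ∑ k, (gram2 g)⁻¹ l k • g k

/-- Lagrange's identity. It replaces the area density by the norm of a cross product, which is
manifestly regular where it does not vanish. -/
theorem det_gram2 (g : Fin 2 → E3) : (gram2 g).det = ‖cross (g 0) (g 1)‖ ^ 2 := by
  rw [Matrix.det_fin_two, norm_cross_sq]; simp [gram2]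

theorem sqrt_det_gram2 (g : Fin 2 → E3) :
    Real.sqrt (gram2 g).det = ‖cross (g 0) (g 1)‖ := by
  rw [det_gram2, Real.sqrt_sq (norm_nonneg _)]

theorem det_gram2_ne_zero {g : Fin 2 → E3} (hg : LinearIndependent ℝ g) : (gram2 g).det ≠ 0 := by
  rw [det_gram2]; exact pow_ne_zero _ (norm_ne_zero_iff.2 (cross_ne_zero hg))

theorem gram2_transpose (g : Fin 2 → E3) : (gram2 g).transpose = gram2 g := by
  ext i j; simp [gram2, real_inner_comm]

theorem gram2_inv_symm (g : Fin 2 → E3) (i j : Fin 2) : (gram2 g)⁻¹ i j = (gram2 g)⁻¹ j i := by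
  conv_lhs => rw [← gram2_transpose, ← Matrix.transpose_nonsing_inv, Matrix.transpose_apply]

theorem inner_dual2 {g : Fin 2 → E3} (hg : LinearIndependent ℝ g) (l k : Fin 2) :
    inner ℝ (dual2 g l) (g k) = if l = k then 1 else 0 := by
  have h := Matrix.nonsing_inv_mul (gram2 g) (Ne.isUnit (det_gram2_ne_zero hg))
  have := congrFun (congrFun h l) k
  rw [Matrix.mul_apply, Matrix.one_apply] at this
  rw [← this, dual2, sum_inner]
  simp [inner_smul_left, gram2]

theorem dual2_mem_span (g : Fin 2 → E3) (l : Fin 2) :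
    dual2 g l ∈ Submodule.span ℝ (Set.range g) :=
  Submodule.sum_mem _ fun k _ => Submodule.smul_mem _ _ (Submodule.subset_span ⟨k, rfl⟩)

/-- The difference of the two vectors lies in the plane and is orthogonal to it. -/
theorem eq_dual2 {g : Fin 2 → E3} (hg : LinearIndependent ℝ g) {l : Fin 2} {v : E3}
    (hv : v ∈ Submodule.span ℝ (Set.range g))
    (h : ∀ k, inner ℝ v (g k) = if l = k then (1 : ℝ) else 0) : v = dual2 g l := by
  rw [← sub_eq_zero, ← inner_self_eq_zero (𝕜 := ℝ)]
  have hmem := Submodule.sub_mem _ hv (dual2_mem_span g l)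
  have : ∀ w ∈ Submodule.span ℝ (Set.range g), inner ℝ (v - dual2 g l) w = 0 := by
    intro w hw
    induction hw using Submodule.span_induction with
    | mem x hx =>
      obtain ⟨k, rfl⟩ := hx
      rw [inner_sub_left, h, inner_dual2 hg, sub_self]
    | zero => simp
    | add x y _ _ hx hy => rw [inner_add_right, hx, hy, add_zero]
    | smul a x _ hx => rw [inner_smul_right, hx, mul_zero]
  exact this _ hmem

/-- The unit normal of the plane spanned by a pair of vectors. -/
noncomputable def normal2 (g : Fin 2 → E3) : E3 :=
  ‖cross (g 0) (g 1)‖⁻¹ • cross (g 0) (g 1)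

theorem norm_normal2 {g : Fin 2 → E3} (hg : LinearIndependent ℝ g) : ‖normal2 g‖ = 1 := by
  have := norm_ne_zero_iff.2 (cross_ne_zero hg)
  rw [normal2, norm_smul, norm_inv, norm_norm, inv_mul_cancel₀ this]

theorem inner_normal2 (g : Fin 2 → E3) (i : Fin 2) : inner ℝ (normal2 g) (g i) = 0 := by
  rw [normal2, inner_smul_left]
  fin_cases i
  · simp [inner_cross_left_self]
  · simp [inner_cross_right_self]

theorem cross_eq_smul_normal2 {g : Fin 2 → E3} (hg : LinearIndependent ℝ g) :
    cross (g 0) (g 1) = ‖cross (g 0) (g 1)‖ • normal2 g := by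
  have := norm_ne_zero_iff.2 (cross_ne_zero hg)
  rw [normal2, smul_smul, mul_inv_cancel₀ this, one_smul]

/-- The right side is tangent, orthogonal to `g 1`, and pairs with `g 0` to the area density.
Writing the scaled dual vector as a cross product avoids differentiating the inverse metric later.
-/
theorem smul_dual2_zero {g : Fin 2 → E3} (hg : LinearIndependent ℝ g) :
    ‖cross (g 0) (g 1)‖ • dual2 g 0 = cross (g 1) (normal2 g) := by
  have h0 := norm_ne_zero_iff.2 (cross_ne_zero hg)
  have : ‖cross (g 0) (g 1)‖⁻¹ • cross (g 1) (normal2 g) = dual2 g 0 := by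
    apply eq_dual2 hg
    · rw [normal2, cross_smul_right, cross_cross_right]
      exact Submodule.smul_mem _ _ (Submodule.smul_mem _ _ (Submodule.sub_mem _
        (Submodule.smul_mem _ _ (Submodule.subset_span ⟨0, rfl⟩))
        (Submodule.smul_mem _ _ (Submodule.subset_span ⟨1, rfl⟩))))
    · intro k
      rw [inner_smul_left]
      fin_cases k
      · simp only [Fin.zero_eta, Fin.isValue]
        rw [inner_cross_perm, inner_cross_perm, normal2, inner_smul_right,
          real_inner_self_eq_norm_sq]
        simp; field_simp
      · simp [inner_cross_left_self]
  rw [← this, smul_smul, mul_inv_cancel₀ h0, one_smul]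

theorem smul_dual2_one {g : Fin 2 → E3} (hg : LinearIndependent ℝ g) :
    ‖cross (g 0) (g 1)‖ • dual2 g 1 = cross (normal2 g) (g 0) := by
  have h0 := norm_ne_zero_iff.2 (cross_ne_zero hg)
  have : ‖cross (g 0) (g 1)‖⁻¹ • cross (normal2 g) (g 0) = dual2 g 1 := by
    apply eq_dual2 hg
    · rw [cross_swap (normal2 g), normal2, cross_smul_right, cross_cross_right, ← smul_neg]
      have hm : ∀ i, g i ∈ Submodule.span ℝ (Set.range g) :=
        fun i => Submodule.subset_span ⟨i, rfl⟩
      exact Submodule.smul_mem _ _ (Submodule.smul_mem _ _ (Submodule.neg_mem _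
        (Submodule.sub_mem _ (Submodule.smul_mem _ _ (hm 0)) (Submodule.smul_mem _ _ (hm 1)))))
    · intro k
      rw [inner_smul_left]
      fin_cases k
      · simp [inner_cross_right_self]
      · simp only [Fin.mk_one, Fin.isValue]
        rw [inner_cross_perm, normal2, inner_smul_right,
          real_inner_self_eq_norm_sq]
        simp; field_simp
  rw [← this, smul_smul, mul_inv_cancel₀ h0, one_smul]

/-- The trace of the Weingarten map in terms of cross products. -/
theorem cross_add_cross_eq {g w : Fin 2 → E3} (hg : LinearIndependent ℝ g)
    (hw : ∀ i, inner ℝ (w i) (normal2 g) = 0) :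
    cross (g 1) (w 0) + cross (w 1) (g 0) =
      (-(‖cross (g 0) (g 1)‖ * ∑ l, inner ℝ (dual2 g l) (w l))) • normal2 g := by
  have hgN : ∀ i, inner ℝ (g i) (normal2 g) = 0 := fun i => by
    rw [real_inner_comm, inner_normal2]
  -- Both cross products join tangent vectors, so each is fixed by its component along the normal;
  -- the scalar identity left over is a triple product expansion.
  rw [cross_eq_inner_smul (norm_normal2 hg) (hgN 1) (hw 0),
    cross_eq_inner_smul (norm_normal2 hg) (hw 1) (hgN 0), ← add_smul, Fin.sum_univ_two, mul_add,
    ← real_inner_smul_left, ← real_inner_smul_left, smul_dual2_zero hg, smul_dual2_one hg]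
  congr 1
  simp only [inner_E3, cross_apply_zero, cross_apply_one, cross_apply_two]; ring

/-- The contraction of a linear map with the dual basis does not depend on the basis. -/
theorem sum_dual2_comp {V W : Type*} [AddCommGroup V] [Module ℝ V]
    [AddCommGroup W] [Module ℝ W] (op : E3 →ₗ[ℝ] V →ₗ[ℝ] W)
    {A A' : ℝ × ℝ →ₗ[ℝ] E3} {B B' : ℝ × ℝ →ₗ[ℝ] V} {M : ℝ × ℝ →ₗ[ℝ] ℝ × ℝ}
    (hA : A = A' ∘ₗ M) (hB : B = B' ∘ₗ M)
    (hg : LinearIndependent ℝ fun i => A (coordDir i))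
    (hg' : LinearIndependent ℝ fun i => A' (coordDir i)) :
    ∑ l, op (dual2 (fun i => A (coordDir i)) l) (B (coordDir l)) =
      ∑ l, op (dual2 (fun i => A' (coordDir i)) l) (B' (coordDir l)) := by
  set g : Fin 2 → E3 := fun i => A (coordDir i) with hgdef
  set g' : Fin 2 → E3 := fun i => A' (coordDir i) with hgdef'
  let m : Fin 2 → Fin 2 → ℝ := fun k l => if k = 0 then (M (coordDir l)).1 else (M (coordDir l)).2
  have hM : ∀ l, M (coordDir l) = ∑ k, m k l • coordDir k := by
    intro l
    ext <;> simp [m, coordDir]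
  have hgm : ∀ l, g l = ∑ k, m k l • g' k := by
    intro l; simp [hgdef, hgdef', hA, hM]
  -- `A` is injective and factors through `M`; hence `M` is also onto and the two bases span the
  -- same plane.
  have hMinj : Function.Injective M := by
    rw [← LinearMap.ker_eq_bot, LinearMap.ker_eq_bot']
    intro v hv
    have h1 : A v = 0 := by rw [hA]; simp [hv]
    have hv' : v = v.1 • coordDir 0 + v.2 • coordDir 1 := by ext <;> simp [coordDir]
    rw [hv', map_add, map_smul, map_smul] at h1
    have h2 := Fintype.linearIndependent_iff.1 hg ![v.1, v.2] (by simpa [hgdef] using h1)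
    ext
    · simpa using h2 0
    · simpa using h2 1
  have hspan : ∀ k, g' k ∈ Submodule.span ℝ (Set.range g) := by
    intro k
    obtain ⟨v, hv⟩ := (LinearMap.injective_iff_surjective.1 hMinj) (coordDir k)
    have hv' : v = v.1 • coordDir 0 + v.2 • coordDir 1 := by ext <;> simp [coordDir]
    have : g' k = A v := by rw [hA]; simp [hgdef', hv]
    rw [this, hv', map_add, map_smul, map_smul]
    exact Submodule.add_mem _ (Submodule.smul_mem _ _ (Submodule.subset_span ⟨0, rfl⟩))
      (Submodule.smul_mem _ _ (Submodule.subset_span ⟨1, rfl⟩))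
  have hspan' : Submodule.span ℝ (Set.range g') = Submodule.span ℝ (Set.range g) := by
    apply le_antisymm
    · rw [Submodule.span_le]; rintro _ ⟨k, rfl⟩; exact hspan k
    · rw [Submodule.span_le]; rintro _ ⟨k, rfl⟩
      rw [SetLike.mem_coe, hgm]
      exact Submodule.sum_mem _ fun i _ => Submodule.smul_mem _ _ (Submodule.subset_span ⟨i, rfl⟩)
  -- Dual vectors transform by the transpose of the matrix that transforms `g` and `B`, so the
  -- invariance reduces to exchanging two sums.
  have hdual : ∀ k, dual2 g' k = ∑ l, m k l • dual2 g l := by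
    intro k
    rw [← sub_eq_zero, ← inner_self_eq_zero (𝕜 := ℝ)]
    have hmem : dual2 g' k - ∑ l, m k l • dual2 g l ∈ Submodule.span ℝ (Set.range g) := by
      refine Submodule.sub_mem _ (hspan' ▸ dual2_mem_span g' k) ?_
      exact Submodule.sum_mem _ fun i _ => Submodule.smul_mem _ _ (dual2_mem_span g i)
    have : ∀ w ∈ Submodule.span ℝ (Set.range g),
        inner ℝ (dual2 g' k - ∑ l, m k l • dual2 g l) w = 0 := by
      intro w hw
      induction hw using Submodule.span_induction with
      | mem x hx =>
        obtain ⟨j, rfl⟩ := hx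
        rw [inner_sub_left, sum_inner]
        simp only [real_inner_smul_left, inner_dual2 hg]
        rw [hgm j, inner_sum]
        simp only [real_inner_smul_right, inner_dual2 hg']
        simp
      | zero => simp
      | add x y _ _ hx hy => rw [inner_add_right, hx, hy, add_zero]
      | smul a x _ hx => rw [inner_smul_right, hx, mul_zero]
    exact this _ hmem
  have hBm : ∀ l, B (coordDir l) = ∑ k, m k l • B' (coordDir k) := by
    intro l; simp [hB, hM]
  simp only [hBm, hdual, map_sum, map_smul, LinearMap.sum_apply, LinearMap.smul_apply]
  exact Finset.sum_comm

/-- The cross product of the two images is multiplied by `det M`. This is the Jacobian factor that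
makes area elements agree on overlaps. -/
theorem gram2_det_comp {A A' : ℝ × ℝ →ₗ[ℝ] E3} {M : ℝ × ℝ →ₗ[ℝ] ℝ × ℝ} (hA : A = A' ∘ₗ M) :
    Real.sqrt (gram2 fun i => A (coordDir i)).det =
      |LinearMap.det M| * Real.sqrt (gram2 fun i => A' (coordDir i)).det := by
  have hM : ∀ l, M (coordDir l) = (M (coordDir l)).1 • coordDir 0 +
      (M (coordDir l)).2 • coordDir 1 := by
    intro l; ext <;> simp [coordDir]
  have hdet : LinearMap.det M = (M (coordDir 0)).1 * (M (coordDir 1)).2 -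
      (M (coordDir 1)).1 * (M (coordDir 0)).2 := by
    rw [← LinearMap.det_toMatrix (Module.Basis.finTwoProd ℝ), Matrix.det_fin_two]
    simp [LinearMap.toMatrix_apply, coordDir]
  rw [sqrt_det_gram2, sqrt_det_gram2, hdet, ← Real.norm_eq_abs, ← norm_smul]
  congr 1
  have h : ∀ l, A (coordDir l) = (M (coordDir l)).1 • A' (coordDir 0) +
      (M (coordDir l)).2 • A' (coordDir 1) := by
    intro l; rw [hA, LinearMap.comp_apply]; conv_lhs => rw [hM l, map_add, map_smul, map_smul]
  simp only [h]
  apply E3_ext <;>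
  simp only [cross_apply_zero, cross_apply_one, cross_apply_two, PiLp.add_apply,
    PiLp.smul_apply, smul_eq_mul] <;> ring

/-! ### Suprema of compatible measures. -/

section SupMeasure

open Set

variable {α : Type*} [MeasurableSpace α]

/-- A supremum of measures is not computed set by set, so an upper bound is exhibited: the supremum
off `A` plus `κ` dominates every `ν j`. No countability of the index set is used, which matters
because there are uncountably many charts. -/
theorem iSup_restrict_le {ι : Type*} {ν : ι → Measure α} {A : Set α} {κ : Measure α}
    (hA : MeasurableSet A) (h : ∀ j, (ν j).restrict A ≤ κ) : (⨆ j, ν j).restrict A ≤ κ := by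
  have hle : (⨆ j, ν j) ≤ (⨆ j, ν j).restrict Aᶜ + κ := by
    refine iSup_le fun j => ?_
    rw [← Measure.restrict_compl_add_restrict (μ := ν j) hA]
    exact add_le_add (Measure.restrict_mono le_rfl (le_iSup ν j)) (h j)
  refine (Measure.restrict_mono (le_refl A) hle).trans ?_
  rw [Measure.restrict_add, Measure.restrict_restrict hA, inter_compl_self, Measure.restrict_empty,
    zero_add]
  exact Measure.restrict_le_self

/-- The supremum of a compatible family of measures restricts to each of them on its patch. -/
theorem restrict_iSup_of_compatible {ι : Type*} {ν : ι → Measure α} {P : ι → Set α}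
    (hP : ∀ i, MeasurableSet (P i)) (hself : ∀ i, (ν i).restrict (P i) = ν i)
    (hcomp : ∀ i j, (ν j).restrict (P i) ≤ ν i) (i : ι) :
    (⨆ j, ν j).restrict (P i) = ν i := by
  refine le_antisymm (iSup_restrict_le (hP i) (hcomp i)) ?_
  conv_lhs => rw [← hself i]
  exact Measure.restrict_mono le_rfl (le_iSup ν i)

theorem iSup_measure_apply_eq_zero {ι : Type*} {ν : ι → Measure α} {A : Set α}
    (hA : MeasurableSet A) (h : ∀ i, ν i A = 0) : (⨆ i, ν i) A = 0 := by
  rw [← Measure.restrict_eq_zero]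
  exact le_antisymm (iSup_restrict_le hA fun j => (Measure.restrict_eq_zero.2 (h j)).le)
    (Measure.zero_le _)

end SupMeasure

/-! ### Integration against the image of a measure with density. -/

section PushDensity

open Set Filter Topology

variable {α β : Type*} [MeasurableSpace α] [TopologicalSpace α] [BorelSpace α]
  [MeasurableSpace β] [TopologicalSpace β] [BorelSpace β]
  {V : Type*} [NormedAddCommGroup V] [NormedSpace ℝ V]
  {μ : Measure α} {f : α → β} {s : Set α} {ρ : α → ℝ}

theorem measurableSet_inter_preimage_of_continuousOn (hs : MeasurableSet s) (hf : ContinuousOn f s)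
    {A : Set β} (hA : MeasurableSet A) : MeasurableSet (s ∩ f ⁻¹' A) := by
  have h := (continuousOn_iff_continuous_domRestrict.1 hf).measurable hA
  have := (MeasurableEmbedding.subtype_coe hs).measurableSet_image.2 h
  convert this using 1
  ext x
  simp [and_comm]

theorem map_withDensity_apply [SFinite μ] (hs : MeasurableSet s) (hf : ContinuousOn f s)
    {A : Set β} (hA : MeasurableSet A) :
    Measure.map f ((μ.restrict s).withDensity fun x => ENNReal.ofReal (ρ x)) A =
      ∫⁻ x in s ∩ f ⁻¹' A, ENNReal.ofReal (ρ x) ∂μ := by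
  have hfm : AEMeasurable f (μ.restrict s) := hf.aemeasurable hs
  rw [Measure.map_apply_of_aemeasurable
    (hfm.mono_ac (withDensity_absolutelyContinuous _ _)) hA, withDensity_apply',
    Measure.restrict_restrict' hs, inter_comm]

theorem map_withDensity_eq (hs : MeasurableSet s) (hf : ContinuousOn f s) :
    Measure.map f ((μ.restrict s).withDensity fun x => ENNReal.ofReal (ρ x)) =
      Measure.map (s.domRestrict f) (Measure.comap (Subtype.val : s → α)
        (μ.withDensity fun x => ENNReal.ofReal (ρ x))) := by
  have hfm : AEMeasurable f (μ.restrict s) := hf.aemeasurable hs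
  rw [← restrict_withDensity hs, ← map_comap_subtype_coe hs,
    AEMeasurable.map_map_of_aemeasurable _ measurable_subtype_coe.aemeasurable]
  · rfl
  · rw [map_comap_subtype_coe hs, restrict_withDensity hs]
    exact hfm.mono_ac (withDensity_absolutelyContinuous _ _)

variable [PolishSpace α] [PolishSpace β]

/-- Restricted to `s`, the injective continuous map is a measurable embedding of Borel spaces
(Lusin–Souslin), so no measurability of `F` is required. This suits integrands that are defined by
choosing charts. -/
theorem integrable_map_withDensity_iff (hs : MeasurableSet s) (hf : ContinuousOn f s)
    (hi : InjOn f s) (hρ : ContinuousOn ρ s) (hρ0 : ∀ x ∈ s, 0 ≤ ρ x) {F : β → V} :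
    Integrable F (Measure.map f ((μ.restrict s).withDensity fun x => ENNReal.ofReal (ρ x))) ↔
      IntegrableOn (fun x => ρ x • F (f x)) s μ := by
  have he := hf.measurableEmbedding hs hi
  have hρm : AEMeasurable (fun x => ENNReal.ofReal (ρ x)) (μ.restrict s) :=
    (hρ.aemeasurable hs).ennreal_ofReal
  rw [map_withDensity_eq hs hf, he.integrable_map_iff]
  have : F ∘ s.domRestrict f = (F ∘ f) ∘ (Subtype.val : s → α) := rfl
  rw [this, ← (MeasurableEmbedding.subtype_coe hs).integrable_map_iff, map_comap_subtype_coe hs,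
    restrict_withDensity hs, integrable_withDensity_iff_integrable_smul₀' hρm
      (Eventually.of_forall fun _ => ENNReal.ofReal_lt_top), IntegrableOn]
  refine integrable_congr ?_
  filter_upwards [ae_restrict_mem hs] with x hx
  simp [ENNReal.toReal_ofReal (hρ0 x hx)]

theorem integral_map_withDensity (hs : MeasurableSet s) (hf : ContinuousOn f s)
    (hi : InjOn f s) (hρ : ContinuousOn ρ s) (hρ0 : ∀ x ∈ s, 0 ≤ ρ x) {F : β → V} :
    ∫ y, F y ∂(Measure.map f ((μ.restrict s).withDensity fun x => ENNReal.ofReal (ρ x))) =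
      ∫ x in s, ρ x • F (f x) ∂μ := by
  have he := hf.measurableEmbedding hs hi
  have hρm : AEMeasurable (fun x => ENNReal.ofReal (ρ x)) (μ.restrict s) :=
    (hρ.aemeasurable hs).ennreal_ofReal
  rw [map_withDensity_eq hs hf, he.integral_map]
  change ∫ x : s, (F ∘ f) x.1 ∂_ = _
  rw [integral_subtype_comap hs,
    restrict_withDensity hs, integral_withDensity_eq_integral_toReal_smul₀ hρm
      (Eventually.of_forall fun _ => ENNReal.ofReal_lt_top)]
  refine integral_congr_ae ?_
  filter_upwards [ae_restrict_mem hs] with x hx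
  simp [ENNReal.toReal_ofReal (hρ0 x hx)]

end PushDensity

/-! ### Epigraphs of Lipschitz functions. -/

section Epigraph

open Set Filter Topology

/-- By the Lipschitz bound, each point of the epigraph is the apex of an upward cone of slope `K`
inside it, a convex set with interior. Derivatives within the parameter domain are thus unique even
at corners. -/
theorem uniqueDiffOn_epigraph {h : ℝ → ℝ} {K : NNReal} (hh : LipschitzWith K h) :
    UniqueDiffOn ℝ {x : ℝ × ℝ | h x.1 ≤ x.2} := by
  intro x hx
  let C : Set (ℝ × ℝ) := {z | x.2 + K * |z.1 - x.1| ≤ z.2}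
  have hsub : C ⊆ {x : ℝ × ℝ | h x.1 ≤ x.2} := by
    intro z hz
    have h1 := hh.dist_le_mul z.1 x.1
    rw [Real.dist_eq, Real.dist_eq] at h1
    have h2 : h z.1 - h x.1 ≤ K * |z.1 - x.1| := (le_abs_self _).trans h1
    simp only [C, mem_ofPred_eq] at hx hz ⊢
    linarith
  have hconv : Convex ℝ C := by
    have : ConvexOn ℝ univ fun t : ℝ => x.2 + K * |t - x.1| := by
      have h1 : ConvexOn ℝ univ fun t : ℝ => |t - x.1| := by
        have := (convexOn_norm (E := ℝ) convex_univ).translate_left (-x.1)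
        simpa [Function.comp_def, sub_eq_add_neg] using this
      exact (convexOn_const x.2 convex_univ).add (h1.smul K.2)
    have := this.convex_epigraph
    simpa [C] using this
  have hint : (interior C).Nonempty := by
    refine ⟨(x.1, x.2 + 1), ?_⟩
    apply interior_maximal (t := {z : ℝ × ℝ | x.2 + K * |z.1 - x.1| < z.2})
    · intro z hz; exact (show x.2 + K * |z.1 - x.1| < z.2 from hz).le
    · exact isOpen_lt (by fun_prop) (by fun_prop)
    · simp
  have hxC : x ∈ closure C := subset_closure (by simp [C])
  exact (uniqueDiffWithinAt_convex hconv hint hxC).mono hsub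

theorem isClosed_epigraph {h : ℝ → ℝ} (hh : Continuous h) :
    IsClosed {x : ℝ × ℝ | h x.1 ≤ x.2} :=
  isClosed_le (hh.comp continuous_fst) continuous_snd

end Epigraph

/-! ### First properties of local parametrizations. -/

namespace LocalParam

open Set Filter Topology

variable {S : Set E3} (c : LocalParam S)

theorem continuous_h : Continuous c.h := by
  obtain ⟨K, hK⟩ := c.lipschitz_h
  exact hK.continuous

theorem dom_eq : c.dom = c.U ∩ {x : ℝ × ℝ | c.h x.1 ≤ x.2} := rfl

theorem dom_subset : c.dom ⊆ c.U := fun _ hx => hx.1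

theorem uniqueDiffOn_dom : UniqueDiffOn ℝ c.dom := by
  obtain ⟨K, hK⟩ := c.lipschitz_h
  rw [dom_eq, inter_comm]
  exact (uniqueDiffOn_epigraph hK).inter c.isOpen_U

theorem measurableSet_dom : MeasurableSet c.dom :=
  c.isOpen_U.measurableSet.inter (isClosed_epigraph c.continuous_h).measurableSet

theorem contDiffAt_map {x : ℝ × ℝ} (hx : x ∈ c.U) : ContDiffAt ℝ 2 c.map x :=
  c.contDiffOn_map.contDiffAt (c.isOpen_U.mem_nhds hx)

theorem hasStrictFDerivAt_map {x : ℝ × ℝ} (hx : x ∈ c.U) :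
    HasStrictFDerivAt c.map (fderiv ℝ c.map x) x :=
  (c.contDiffAt_map hx).hasStrictFDerivAt (by norm_num)

theorem hasFDerivAt_map {x : ℝ × ℝ} (hx : x ∈ c.U) : HasFDerivAt c.map (fderiv ℝ c.map x) x :=
  (c.hasStrictFDerivAt_map hx).hasFDerivAt

theorem continuousOn_map : ContinuousOn c.map c.dom :=
  c.contDiffOn_map.continuousOn.mono c.dom_subset

theorem injOn_map : InjOn c.map c.dom :=
  injOn_iff_injective.2 c.isEmbedding.injective

theorem contDiffOn_g (i : Fin 2) : ContDiffOn ℝ 1 (c.g i) c.U := by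
  have := c.contDiffOn_map.fderiv_of_isOpen (m := 1) c.isOpen_U (by norm_num)
  exact this.clm_apply contDiffOn_const

theorem linearIndependent_g {x : ℝ × ℝ} (hx : x ∈ c.dom) :
    LinearIndependent ℝ (fun i => c.g i x) :=
  c.linearIndependent x hx.1 hx.2

theorem metric_eq (x : ℝ × ℝ) : c.metric x = gram2 fun i => c.g i x := rfl

theorem map_mem {x : ℝ × ℝ} (hx : x ∈ c.dom) : c.map x ∈ S := by
  obtain ⟨W, -, hW⟩ := c.image_open
  exact (hW.subset ⟨x, hx, rfl⟩).1

theorem nhdsWithin_dom_eq {x : ℝ × ℝ} (hx : x ∈ c.dom) :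
    𝓝[c.dom] x = comap c.map (𝓝 (c.map x)) ⊓ 𝓟 c.dom := by
  have h := c.isEmbedding.isInducing.nhds_eq_comap ⟨x, hx⟩
  change 𝓝 (⟨x, hx⟩ : c.dom) = _ at h
  rw [nhdsWithin_eq_map_subtype_coe hx, h]
  change Filter.map _ (comap (c.map ∘ Subtype.val) (𝓝 (c.map x))) = _
  rw [← comap_comap, ← subtype_coe_map_comap]

/-- The image of the parameter domain. -/
def patch : Set E3 := c.map '' c.dom

theorem patch_mem_nhdsWithin {y : E3} (hy : y ∈ c.patch) : c.patch ∈ 𝓝[S] y := by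
  obtain ⟨W, hWo, hW⟩ := c.image_open
  have : c.patch = S ∩ W := hW
  rw [this] at hy ⊢
  exact inter_mem self_mem_nhdsWithin (mem_nhdsWithin_of_mem_nhds (hWo.mem_nhds hy.2))

theorem measurableSet_patch : MeasurableSet c.patch :=
  c.measurableSet_dom.image_of_continuousOn_injOn c.continuousOn_map c.injOn_map

theorem tendsto_map {x : ℝ × ℝ} (hx : x ∈ c.dom) :
    Tendsto c.map (𝓝[c.dom] x) (𝓝[S] (c.map x)) :=
  tendsto_nhdsWithin_iff.2 ⟨c.continuousOn_map x hx,
    eventually_nhdsWithin_of_forall fun _ hz => c.map_mem hz⟩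

end LocalParam

/-! ### Coordinate changes and invariance of the contraction. -/

namespace LocalParam

open Set Filter Topology

variable {S : Set E3}

theorem fderiv_map_injective (c : LocalParam S) {x : ℝ × ℝ} (hx : x ∈ c.dom) :
    Function.Injective (fderiv ℝ c.map x) := by
  rw [injective_iff_map_eq_zero]
  intro v hv
  have hv' : v = v.1 • coordDir 0 + v.2 • coordDir 1 := by ext <;> simp [coordDir]
  rw [hv', map_add, map_smul, map_smul] at hv
  have h2 := Fintype.linearIndependent_iff.1 (c.linearIndependent_g hx) ![v.1, v.2]
    (by simpa [g] using hv)
  ext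
  · simpa using h2 0
  · simpa using h2 1

/-- A local parametrization has a differentiable local left inverse on the ambient space. -/
theorem exists_leftInverse (c : LocalParam S) {x : ℝ × ℝ} (hx : x ∈ c.dom) :
    ∃ (Λ : E3 → ℝ × ℝ) (Λ' : E3 →L[ℝ] ℝ × ℝ), HasStrictFDerivAt Λ Λ' (c.map x) ∧
      ∀ᶠ z in 𝓝 x, Λ (c.map z) = z := by
  obtain ⟨L, hL⟩ := (fderiv ℝ c.map x : ℝ × ℝ →ₗ[ℝ] E3).exists_leftInverse_of_injective
    (LinearMap.ker_eq_bot.2 (c.fderiv_map_injective hx))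
  let L' : E3 →L[ℝ] ℝ × ℝ := LinearMap.toContinuousLinearMap L
  have hcomp : L'.comp (fderiv ℝ c.map x) =
      ((ContinuousLinearEquiv.refl ℝ (ℝ × ℝ) : (ℝ × ℝ) ≃L[ℝ] ℝ × ℝ) : ℝ × ℝ →L[ℝ] ℝ × ℝ) := by
    exact ContinuousLinearMap.ext fun v => LinearMap.congr_fun hL v
  have hs : HasStrictFDerivAt (L' ∘ c.map)
      ((ContinuousLinearEquiv.refl ℝ (ℝ × ℝ) : (ℝ × ℝ) ≃L[ℝ] ℝ × ℝ) : ℝ × ℝ →L[ℝ] ℝ × ℝ) x := by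
    rw [← hcomp]
    exact L'.hasStrictFDerivAt.comp x (c.hasStrictFDerivAt_map hx.1)
  -- Composing with a linear left inverse of the derivative gives a planar map with identity
  -- derivative, to which the inverse function theorem applies. The construction works at boundary
  -- points too, because the parametrization is defined on all of `U`.
  have hinv : HasStrictFDerivAt (hs.localInverse _ _ _) _ (L' (c.map x)) := hs.to_localInverse
  refine ⟨hs.localInverse _ _ _ ∘ L', _, hinv.comp (c.map x) L'.hasStrictFDerivAt, ?_⟩
  exact hs.eventually_left_inverse

/-- The coordinate change from one local parametrization to another one. -/
noncomputable def trans (c c' : LocalParam S) (x : ℝ × ℝ) : ℝ × ℝ :=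
  Function.invFunOn c'.map c'.dom (c.map x)

theorem trans_mem (c c' : LocalParam S) {x : ℝ × ℝ} (hx : c.map x ∈ c'.patch) :
    c.trans c' x ∈ c'.dom := Function.invFunOn_mem hx

theorem map_trans (c c' : LocalParam S) {x : ℝ × ℝ} (hx : c.map x ∈ c'.patch) :
    c'.map (c.trans c' x) = c.map x := Function.invFunOn_eq hx

theorem trans_eq (c c' : LocalParam S) {x x' : ℝ × ℝ} (hx' : x' ∈ c'.dom)
    (h : c.map x = c'.map x') : c.trans c' x = x' := by
  have hp : c.map x ∈ c'.patch := ⟨x', hx', h.symm⟩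
  exact c'.injOn_map (c.trans_mem c' hp) hx' ((c.map_trans c' hp).trans h)

theorem eventually_mem_patch (c c' : LocalParam S) {x : ℝ × ℝ} (hx : x ∈ c.dom)
    (h : c.map x ∈ c'.patch) : ∀ᶠ z in 𝓝[c.dom] x, c.map z ∈ c'.patch :=
  c.tendsto_map hx (c'.patch_mem_nhdsWithin h)

theorem tendsto_trans (c c' : LocalParam S) {x : ℝ × ℝ} (hx : x ∈ c.dom)
    (h : c.map x ∈ c'.patch) :
    Tendsto (c.trans c') (𝓝[c.dom] x) (𝓝[c'.dom] (c.trans c' x)) := by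
  rw [c'.nhdsWithin_dom_eq (c.trans_mem c' h), c.map_trans c' h]
  refine tendsto_inf.2 ⟨?_, tendsto_principal.2 ?_⟩
  · rw [tendsto_comap_iff]
    refine Tendsto.congr' ?_ (c.continuousOn_map x hx)
    filter_upwards [c.eventually_mem_patch c' hx h] with z hz
    exact (c.map_trans c' hz).symm
  · filter_upwards [c.eventually_mem_patch c' hx h] with z hz
    exact c.trans_mem c' hz

/-- Near each point, the coordinate change extends to a strictly differentiable map of open sets,
with invertible derivative. -/
theorem exists_hasStrictFDerivAt_trans (c c' : LocalParam S) {x : ℝ × ℝ} (hx : x ∈ c.dom)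
    (h : c.map x ∈ c'.patch) :
    ∃ (ψ : ℝ × ℝ → ℝ × ℝ) (M : (ℝ × ℝ) ≃L[ℝ] ℝ × ℝ),
      HasStrictFDerivAt ψ (M : ℝ × ℝ →L[ℝ] ℝ × ℝ) x ∧
      c.trans c' =ᶠ[𝓝[c.dom] x] ψ ∧
      fderiv ℝ c.map x = (fderiv ℝ c'.map (c.trans c' x)).comp (M : ℝ × ℝ →L[ℝ] ℝ × ℝ) := by
  have hx' := c.trans_mem c' h
  obtain ⟨Λ, Λ', hΛ, hinv⟩ := c'.exists_leftInverse hx'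
  rw [c.map_trans c' h] at hΛ
  have hψ := hΛ.comp x (c.hasStrictFDerivAt_map hx.1)
  have heq : c.trans c' =ᶠ[𝓝[c.dom] x] Λ ∘ c.map := by
    have h1 := (c.tendsto_trans c' hx h).mono_right nhdsWithin_le_nhds hinv
    filter_upwards [h1, c.eventually_mem_patch c' hx h] with z hz hz'
    rw [Function.comp_apply, ← c.map_trans c' hz']
    exact hz.symm
  have hd : HasFDerivWithinAt (c.trans c') (Λ'.comp (fderiv ℝ c.map x)) c.dom x :=
    hψ.hasFDerivAt.hasFDerivWithinAt.congr_of_eventuallyEq heq (heq.self_of_nhdsWithin hx)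
  -- Differentiate `c'.map ∘ c.trans c' = c.map` within the domain, where derivatives are unique.
  have hcomp : fderiv ℝ c.map x =
      (fderiv ℝ c'.map (c.trans c' x)).comp (Λ'.comp (fderiv ℝ c.map x)) := by
    have h1 := (c'.hasFDerivAt_map hx'.1).comp_hasFDerivWithinAt x hd
    have h2 : HasFDerivWithinAt c.map ((fderiv ℝ c'.map (c.trans c' x)).comp
        (Λ'.comp (fderiv ℝ c.map x))) c.dom x := by
      refine h1.congr_of_eventuallyEq ?_ (c.map_trans c' h).symm
      filter_upwards [c.eventually_mem_patch c' hx h] with z hz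
      exact (c.map_trans c' hz).symm
    exact (c.uniqueDiffOn_dom x hx).eq (c.hasFDerivAt_map hx.1).hasFDerivWithinAt h2
  have hinj : Function.Injective (Λ'.comp (fderiv ℝ c.map x)) := by
    have := c.fderiv_map_injective hx
    rw [hcomp] at this
    exact Function.Injective.of_comp this
  let M : (ℝ × ℝ) ≃L[ℝ] ℝ × ℝ := (LinearEquiv.ofInjectiveEndo _ hinj).toContinuousLinearEquiv
  have hM : (M : ℝ × ℝ →L[ℝ] ℝ × ℝ) = Λ'.comp (fderiv ℝ c.map x) := by
    exact ContinuousLinearMap.ext fun v => rfl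
  exact ⟨Λ ∘ c.map, M, hM ▸ hψ, heq, hM ▸ hcomp⟩

/-- Coordinate changes map interior points to interior points. -/
theorem trans_interior (c c' : LocalParam S) {x : ℝ × ℝ} (hx : x ∈ c.dom)
    (h : c.map x ∈ c'.patch) (hlt : c.h x.1 < x.2) :
    c'.h (c.trans c' x).1 < (c.trans c' x).2 := by
  have hx' := c.trans_mem c' h
  refine lt_of_le_of_ne hx'.2 fun heq0 => ?_
  obtain ⟨ψ, M, hψ, heq, -⟩ := c.exists_hasStrictFDerivAt_trans c' hx h
  have hnhds : c.dom ∈ 𝓝 x := by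
    refine inter_mem (c.isOpen_U.mem_nhds hx.1) ?_
    have : {z : ℝ × ℝ | c.h z.1 < z.2} ∈ 𝓝 x :=
      (isOpen_lt (c.continuous_h.comp continuous_fst) continuous_snd).mem_nhds hlt
    filter_upwards [this] with z hz using le_of_lt hz
  -- The extension `ψ` is open at `x`, so the image of a neighbourhood of `x` fills a neighbourhood
  -- of its value. At a point of the graph, `c'.dom` would miss the points just below.
  have hmap : Filter.map ψ (𝓝 x) = 𝓝 (c.trans c' x) := by
    rw [heq.self_of_nhdsWithin hx]
    exact hψ.map_nhds_eq_of_equiv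
  have hmem : c'.dom ∈ 𝓝 (c.trans c' x) := by
    have h1 := c.tendsto_trans c' hx h self_mem_nhdsWithin
    rw [← hmap, Filter.mem_map]
    rw [nhdsWithin_eq_nhds.2 hnhds] at h1 heq
    filter_upwards [h1, heq] with z hz hz'
    rw [mem_preimage, ← hz']
    exact hz
  have hcont : Tendsto (fun t : ℝ => ((c.trans c' x).1, t)) (𝓝 (c.trans c' x).2)
      (𝓝 (c.trans c' x)) := by
    have : Continuous fun t : ℝ => ((c.trans c' x).1, t) := by fun_prop
    exact this.tendsto' _ _ rfl
  have h2 := (hcont hmem)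
  obtain ⟨t, ht, ht'⟩ := Filter.nonempty_of_mem
    (inter_mem (mem_nhdsWithin_of_mem_nhds h2) (self_mem_nhdsWithin (s := Iio (c.trans c' x).2)))
  have : c'.h (c.trans c' x).1 ≤ t := ht.2
  rw [heq0] at this
  exact absurd ht' (not_lt.2 this)

/-- Coordinate changes map boundary points to boundary points. -/
theorem trans_boundary (c c' : LocalParam S) {x : ℝ × ℝ} (hx : x ∈ c.dom)
    (h : c.map x ∈ c'.patch) (hb : c.h x.1 = x.2) :
    c'.h (c.trans c' x).1 = (c.trans c' x).2 := by
  have hx' := c.trans_mem c' h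
  by_contra hne
  have hlt := lt_of_le_of_ne hx'.2 hne
  have hp : c'.map (c.trans c' x) ∈ c.patch := ⟨x, hx, (c.map_trans c' h).symm⟩
  have h1 := c'.trans_interior c hx' hp hlt
  rw [c'.trans_eq c hx (c.map_trans c' h)] at h1
  exact h1.ne hb

section WellDefined

variable {V W : Type*} [NormedAddCommGroup V] [NormedSpace ℝ V] [NormedAddCommGroup W]
  [NormedSpace ℝ W]

/-- The contraction `g^l ∘ ∂Ψ/∂x^l` of a field on a surface. -/
noncomputable def contraction (op : E3 →L[ℝ] V →L[ℝ] W) (Ψ : E3 → V) (c : LocalParam S)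
    (x : ℝ × ℝ) : W :=
  ∑ l, op (c.gDual l x) (fderivWithin ℝ (Ψ ∘ c.map) c.dom x (coordDir l))

/-- By the chain rule the derivatives of the parametrization and of the field are both transported
by the same linear map, and `sum_dual2_comp` applies. -/
theorem contraction_eq_of_map_eq (op : E3 →L[ℝ] V →L[ℝ] W) {Ψ : E3 → V} {c c' : LocalParam S}
    {x x' : ℝ × ℝ} (hx : x ∈ c.dom) (hx' : x' ∈ c'.dom) (h : c.map x = c'.map x')
    (hΨ : DifferentiableWithinAt ℝ (Ψ ∘ c'.map) c'.dom x') :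
    contraction op Ψ c x = contraction op Ψ c' x' := by
  have hp : c.map x ∈ c'.patch := ⟨x', hx', h.symm⟩
  obtain ⟨ψ, M, hψ, heq, hM⟩ := c.exists_hasStrictFDerivAt_trans c' hx hp
  have ht := c.trans_eq c' hx' h
  have htr : HasFDerivWithinAt (c.trans c') (M : ℝ × ℝ →L[ℝ] ℝ × ℝ) c.dom x :=
    hψ.hasFDerivAt.hasFDerivWithinAt.congr_of_eventuallyEq heq (heq.self_of_nhdsWithin hx)
  have hB : fderivWithin ℝ (Ψ ∘ c.map) c.dom x =
      (fderivWithin ℝ (Ψ ∘ c'.map) c'.dom x').comp (M : ℝ × ℝ →L[ℝ] ℝ × ℝ) := by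
    have h1 : HasFDerivWithinAt (Ψ ∘ c'.map) (fderivWithin ℝ (Ψ ∘ c'.map) c'.dom x') c'.dom
        (c.trans c' x) := by rw [ht]; exact hΨ.hasFDerivWithinAt
    have h2 := h1.comp_of_tendsto x htr (c.tendsto_trans c' hx hp)
    refine HasFDerivWithinAt.fderivWithin (h2.congr_of_eventuallyEq ?_ ?_)
      (c.uniqueDiffOn_dom x hx)
    · filter_upwards [c.eventually_mem_patch c' hx hp] with z hz
      simp [c.map_trans c' hz]
    · simp [c.map_trans c' hp]
  rw [ht] at hM
  have := sum_dual2_comp (V := V) (W := W)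
    ((ContinuousLinearMap.coeLM ℝ).comp op.toLinearMap)
    (A := (fderiv ℝ c.map x : ℝ × ℝ →ₗ[ℝ] E3)) (A' := (fderiv ℝ c'.map x' : ℝ × ℝ →ₗ[ℝ] E3))
    (B := (fderivWithin ℝ (Ψ ∘ c.map) c.dom x : ℝ × ℝ →ₗ[ℝ] V))
    (B' := (fderivWithin ℝ (Ψ ∘ c'.map) c'.dom x' : ℝ × ℝ →ₗ[ℝ] V))
    (M := (M : ℝ × ℝ →L[ℝ] ℝ × ℝ)) (by rw [hM]; rfl) (by rw [hB]; rfl)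
    (c.linearIndependent_g hx) (c'.linearIndependent_g hx')
  exact this

theorem atPoint_eq {α : Type*} [Zero α] {F : LocalParam S → ℝ × ℝ → α}
    (hF : ∀ (c c' : LocalParam S), ∀ x ∈ c.dom, ∀ x' ∈ c'.dom, c.map x = c'.map x' →
      F c x = F c' x') (c : LocalParam S) {x : ℝ × ℝ} (hx : x ∈ c.dom) :
    atPoint S F (c.map x) = F c x := by
  have hp : ∃ q : LocalParam S × (ℝ × ℝ), q.2 ∈ q.1.dom ∧ q.1.map q.2 = c.map x :=
    ⟨(c, x), hx, rfl⟩
  rw [atPoint, dif_pos hp]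
  exact hF _ _ _ hp.choose_spec.1 _ hx hp.choose_spec.2

end WellDefined

end LocalParam

/-! ### Area and arc length elements on overlapping charts. -/

namespace LocalParam

open Set Filter Topology

variable {S : Set E3}

theorem sqrt_det_metric (c : LocalParam S) (x : ℝ × ℝ) :
    Real.sqrt (c.metric x).det = ‖cross (c.g 0 x) (c.g 1 x)‖ := sqrt_det_gram2 _

theorem continuousOn_g (c : LocalParam S) (i : Fin 2) : ContinuousOn (c.g i) c.U :=
  (c.contDiffOn_g i).continuousOn

theorem contDiffOn_cross_g (c : LocalParam S) :
    ContDiffOn ℝ 1 (fun x => cross (c.g 0 x) (c.g 1 x)) c.U :=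
  (crossL.contDiff.comp_contDiffOn (c.contDiffOn_g 0)).clm_apply (c.contDiffOn_g 1)

theorem continuousOn_sqrt_det_metric (c : LocalParam S) :
    ContinuousOn (fun x => Real.sqrt (c.metric x).det) c.dom := by
  simp_rw [c.sqrt_det_metric]
  exact c.contDiffOn_cross_g.continuousOn.norm.mono c.dom_subset

theorem area_apply (c : LocalParam S) {A : Set E3} (hA : MeasurableSet A) :
    c.area A = ∫⁻ x in c.dom ∩ c.map ⁻¹' A, ENNReal.ofReal (Real.sqrt (c.metric x).det) :=
  map_withDensity_apply c.measurableSet_dom c.continuousOn_map hA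

theorem area_compl (c : LocalParam S) {A : Set E3} (hA : MeasurableSet A) (h : c.patch ⊆ A) :
    c.area Aᶜ = 0 := by
  rw [c.area_apply hA.compl]
  have : c.dom ∩ c.map ⁻¹' Aᶜ = ∅ := by
    rw [eq_empty_iff_forall_notMem]
    rintro x ⟨hx, hx'⟩
    exact hx' (h ⟨x, hx, rfl⟩)
  rw [this, Measure.restrict_empty, lintegral_zero_measure]

/-- Change of variables along the coordinate change, which is injective and differentiable on the
overlap. One inequality for every pair of charts is all that `restrict_iSup_of_compatible` asks for.
-/
theorem area_restrict_patch_le (c c' : LocalParam S) : c'.area.restrict c.patch ≤ c.area := by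
  refine Measure.le_iff.2 fun A hA => ?_
  have hAP := hA.inter c.measurableSet_patch
  rw [Measure.restrict_apply hA, c'.area_apply hAP, c.area_apply hA]
  set T := c'.dom ∩ c'.map ⁻¹' (A ∩ c.patch) with hT
  have hTm : MeasurableSet T :=
    measurableSet_inter_preimage_of_continuousOn c'.measurableSet_dom c'.continuousOn_map hAP
  have hex : ∀ x, ∃ M : ℝ × ℝ →L[ℝ] ℝ × ℝ, x ∈ T → HasFDerivWithinAt (c'.trans c) M T x ∧
      fderiv ℝ c'.map x = (fderiv ℝ c.map (c'.trans c x)).comp M := by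
    intro x
    by_cases hx : x ∈ T
    · obtain ⟨ψ, M, hψ, heq, hM⟩ := c'.exists_hasStrictFDerivAt_trans c hx.1 hx.2.2
      refine ⟨M, fun _ => ⟨?_, hM⟩⟩
      exact (hψ.hasFDerivAt.hasFDerivWithinAt.congr_of_eventuallyEq heq
        (heq.self_of_nhdsWithin hx.1)).mono inter_subset_left
    · exact ⟨0, fun h => absurd h hx⟩
  choose M hM using hex
  have hinj : InjOn (c'.trans c) T := by
    intro x hx z hz hxz
    refine c'.injOn_map hx.1 hz.1 ?_
    rw [← c'.map_trans c hx.2.2, hxz, c'.map_trans c hz.2.2]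
  have key := lintegral_image_eq_lintegral_abs_det_fderiv_mul volume hTm
    (fun x hx => (hM x hx).1) hinj (fun x => ENNReal.ofReal (Real.sqrt (c.metric x).det))
  have hJ : ∫⁻ x in T, ENNReal.ofReal (Real.sqrt (c'.metric x).det) =
      ∫⁻ x in T, ENNReal.ofReal |(M x).det| *
        ENNReal.ofReal (Real.sqrt (c.metric (c'.trans c x)).det) := by
    refine setLIntegral_congr_fun hTm fun x hx => ?_
    have h1 := gram2_det_comp (A := (fderiv ℝ c'.map x : ℝ × ℝ →ₗ[ℝ] E3))
      (A' := (fderiv ℝ c.map (c'.trans c x) : ℝ × ℝ →ₗ[ℝ] E3)) (M := (M x : ℝ × ℝ →ₗ[ℝ] ℝ × ℝ))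
      (by rw [(hM x hx).2]; rfl)
    rw [← ENNReal.ofReal_mul (abs_nonneg _)]
    exact congrArg ENNReal.ofReal h1
  rw [hJ, ← key]
  refine lintegral_mono_set ?_
  rintro _ ⟨x, hx, rfl⟩
  refine ⟨c'.trans_mem c hx.2.2, ?_⟩
  rw [mem_preimage, c'.map_trans c hx.2.2]
  exact hx.2.1

theorem restrict_eq_self_of_compl {μ : Measure E3} {P : Set E3} (h : μ Pᶜ = 0) :
    μ.restrict P = μ := by
  refine Measure.restrict_eq_self_of_ae_mem ?_
  exact h

theorem areaMeasure_restrict_patch (c : LocalParam S) :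
    (areaMeasure S).restrict c.patch = c.area :=
  restrict_iSup_of_compatible (fun c : LocalParam S => c.measurableSet_patch)
    (fun c => restrict_eq_self_of_compl (c.area_compl c.measurableSet_patch subset_rfl))
    area_restrict_patch_le c

theorem patch_subset (c : LocalParam S) : c.patch ⊆ S := by
  rintro _ ⟨x, hx, rfl⟩; exact c.map_mem hx

/-- The parameters of all boundary points. -/
def fullEdgeDom (c : LocalParam S) : Set ℝ := {s | (s, c.h s) ∈ c.U}

theorem edge_mem_dom (c : LocalParam S) {s : ℝ} (hs : s ∈ c.fullEdgeDom) :
    (s, c.h s) ∈ c.dom := ⟨hs, le_rfl⟩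

theorem edgeDom_subset (c : LocalParam S) : c.edgeDom ⊆ c.fullEdgeDom := fun _ h => h.1

theorem isOpen_fullEdgeDom (c : LocalParam S) : IsOpen c.fullEdgeDom :=
  c.isOpen_U.preimage (continuous_id.prodMk c.continuous_h)

theorem isOpen_edgeDom (c : LocalParam S) : IsOpen c.edgeDom :=
  c.isOpen_fullEdgeDom.sdiff c.corners.finite_toSet.isClosed

theorem tendsto_graph (c : LocalParam S) {s : ℝ} (hs : s ∈ c.fullEdgeDom) :
    Tendsto (fun t => (t, c.h t)) (𝓝 s) (𝓝[c.dom] (s, c.h s)) := by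
  refine tendsto_nhdsWithin_iff.2
    ⟨(continuous_id.prodMk c.continuous_h).tendsto' _ _ rfl, ?_⟩
  filter_upwards [c.isOpen_fullEdgeDom.mem_nhds hs] with t ht using c.edge_mem_dom ht

theorem hasDerivAt_h (c : LocalParam S) {s : ℝ} (hs : s ∉ c.corners) :
    HasDerivAt c.h (deriv c.h s) s := by
  have ho : IsOpen ((c.corners : Set ℝ)ᶜ) := c.corners.finite_toSet.isClosed.isOpen_compl
  have := (c.contDiffOn_h.contDiffAt (ho.mem_nhds hs)).differentiableAt one_ne_zero
  exact this.hasDerivAt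

theorem hasDerivAt_edge (c : LocalParam S) {s : ℝ} (hs : s ∈ c.edgeDom) :
    HasDerivAt c.edge (c.g 0 (s, c.h s) + deriv c.h s • c.g 1 (s, c.h s)) s := by
  have h1 : HasDerivAt (fun t => (t, c.h t)) ((1 : ℝ), deriv c.h s) s :=
    (hasDerivAt_id s).prodMk (c.hasDerivAt_h hs.2)
  have h2 := (c.hasFDerivAt_map hs.1).comp_hasDerivAt s h1
  have h3 : fderiv ℝ c.map (s, c.h s) (1, deriv c.h s) =
      c.g 0 (s, c.h s) + deriv c.h s • c.g 1 (s, c.h s) := by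
    change _ = fderiv ℝ c.map _ (coordDir 0) + deriv c.h s • fderiv ℝ c.map _ (coordDir 1)
    rw [← map_smul, ← map_add]
    congr 1
    ext <;> simp [coordDir]
  rw [← h3]
  exact h2

theorem deriv_edge (c : LocalParam S) {s : ℝ} (hs : s ∈ c.edgeDom) :
    deriv c.edge s = c.g 0 (s, c.h s) + deriv c.h s • c.g 1 (s, c.h s) :=
  (c.hasDerivAt_edge hs).deriv

theorem continuousOn_edge (c : LocalParam S) : ContinuousOn c.edge c.edgeDom :=
  fun _ hs => (c.hasDerivAt_edge hs).continuousAt.continuousWithinAt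

theorem continuousOn_deriv_h (c : LocalParam S) :
    ContinuousOn (deriv c.h) (c.corners : Set ℝ)ᶜ := by
  have ho : IsOpen ((c.corners : Set ℝ)ᶜ) := c.corners.finite_toSet.isClosed.isOpen_compl
  exact c.contDiffOn_h.continuousOn_deriv_of_isOpen ho le_rfl

theorem continuousOn_deriv_edge (c : LocalParam S) : ContinuousOn (deriv c.edge) c.edgeDom := by
  have hg : ∀ i, ContinuousOn (fun s => c.g i (s, c.h s)) c.edgeDom := fun i =>
    (c.continuousOn_g i).comp (continuous_id.prodMk c.continuous_h).continuousOn fun s hs => hs.1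
  refine ContinuousOn.congr (f := fun s => c.g 0 (s, c.h s) + deriv c.h s • c.g 1 (s, c.h s)) ?_
    fun s hs => c.deriv_edge hs
  exact (hg 0).add ((c.continuousOn_deriv_h.mono fun s hs => hs.2).smul (hg 1))

theorem injOn_edge (c : LocalParam S) : InjOn c.edge c.fullEdgeDom := fun _ hs _ ht h =>
  congrArg Prod.fst (c.injOn_map (c.edge_mem_dom hs) (c.edge_mem_dom ht) h)

theorem arcLength_apply (c : LocalParam S) {A : Set E3} (hA : MeasurableSet A) :
    c.arcLength A = ∫⁻ s in c.edgeDom ∩ c.edge ⁻¹' A, ENNReal.ofReal ‖deriv c.edge s‖ :=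
  map_withDensity_apply c.isOpen_edgeDom.measurableSet c.continuousOn_edge hA

theorem edge_mem_patch (c : LocalParam S) {s : ℝ} (hs : s ∈ c.fullEdgeDom) :
    c.edge s ∈ c.patch := ⟨_, c.edge_mem_dom hs, rfl⟩

theorem arcLength_compl (c : LocalParam S) {A : Set E3} (hA : MeasurableSet A) (h : c.patch ⊆ A) :
    c.arcLength Aᶜ = 0 := by
  rw [c.arcLength_apply hA.compl]
  have : c.edgeDom ∩ c.edge ⁻¹' Aᶜ = ∅ := by
    rw [eq_empty_iff_forall_notMem]
    rintro x ⟨hx, hx'⟩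
    exact hx' (h (c.edge_mem_patch hx.1))
  rw [this, Measure.restrict_empty, lintegral_zero_measure]

/-- The coordinate change between the parameters of the boundary curve. -/
noncomputable def edgeTrans (c c' : LocalParam S) (s : ℝ) : ℝ := (c.trans c' (s, c.h s)).1

/-- Boundary points go to boundary points, so the image lies on the graph of `c'.h` and is
determined by its first coordinate. -/
theorem edgeTrans_spec (c c' : LocalParam S) {s : ℝ} (hs : s ∈ c.fullEdgeDom)
    (h : c.edge s ∈ c'.patch) :
    c.edgeTrans c' s ∈ c'.fullEdgeDom ∧ c'.edge (c.edgeTrans c' s) = c.edge s := by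
  have hb := c.trans_boundary c' (c.edge_mem_dom hs) h rfl
  have heq : (c.edgeTrans c' s, c'.h (c.edgeTrans c' s)) = c.trans c' (s, c.h s) :=
    Prod.ext rfl hb
  refine ⟨?_, ?_⟩
  · rw [fullEdgeDom, mem_ofPred_eq, heq]; exact (c.trans_mem c' h).1
  · rw [edge, heq]; exact c.map_trans c' h

theorem exists_hasDerivAt_edgeTrans (c c' : LocalParam S) {s : ℝ} (hs : s ∈ c.edgeDom)
    (h : c.edge s ∈ c'.patch) (hc : c.edgeTrans c' s ∉ c'.corners) :
    ∃ θ' : ℝ, HasDerivAt (c.edgeTrans c') θ' s ∧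
      deriv c.edge s = θ' • deriv c'.edge (c.edgeTrans c' s) := by
  obtain ⟨ψ, M, hψ, heq, -⟩ := c.exists_hasStrictFDerivAt_trans c' (c.edge_mem_dom hs.1) h
  have h1 : HasDerivAt (fun t => (t, c.h t)) ((1 : ℝ), deriv c.h s) s :=
    (hasDerivAt_id s).prodMk (c.hasDerivAt_h hs.2)
  have h2 := (hasFDerivAt_fst (𝕜 := ℝ)).comp_hasDerivAt s (hψ.hasFDerivAt.comp_hasDerivAt s h1)
  have h3 := h2.congr_of_eventuallyEq (f₁ := c.edgeTrans c') (by
    filter_upwards [(c.tendsto_graph hs.1).eventually heq] with t ht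
    simp [edgeTrans, ht])
  refine ⟨_, h3, ?_⟩
  have hs' : c.edgeTrans c' s ∈ c'.edgeDom := ⟨(c.edgeTrans_spec c' hs.1 h).1, hc⟩
  have h4 := (c'.hasDerivAt_edge hs').scomp s h3
  rw [← c'.deriv_edge hs'] at h4
  refine (h4.congr_of_eventuallyEq ?_).deriv
  filter_upwards [(c.tendsto_graph hs.1).eventually
    (c.eventually_mem_patch c' (c.edge_mem_dom hs.1) h), c.isOpen_fullEdgeDom.mem_nhds hs.1]
    with t ht ht'
  exact (c.edgeTrans_spec c' ht' ht).2.symm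

theorem arcLength_restrict_patch_le (c c' : LocalParam S) :
    c'.arcLength.restrict c.patch ≤ c.arcLength := by
  refine Measure.le_iff.2 fun A hA => ?_
  have hAP := hA.inter c.measurableSet_patch
  rw [Measure.restrict_apply hA, c'.arcLength_apply hAP, c.arcLength_apply hA]
  set T := c'.edgeDom ∩ c'.edge ⁻¹' (A ∩ c.patch) with hT
  have hTm : MeasurableSet T := measurableSet_inter_preimage_of_continuousOn
    c'.isOpen_edgeDom.measurableSet c'.continuousOn_edge hAP
  have hinj : InjOn (c'.edgeTrans c) T := by
    intro s hs t ht hst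
    refine c'.injOn_edge hs.1.1 ht.1.1 ?_
    rw [← (c'.edgeTrans_spec c hs.1.1 hs.2.2).2, hst, (c'.edgeTrans_spec c ht.1.1 ht.2.2).2]
  -- A regular parameter of one chart may land on a listed corner of the other. By injectivity this
  -- happens finitely often, and these parameters form a null set.
  have hfin : (T ∩ c'.edgeTrans c ⁻¹' c.corners).Finite := by
    refine Finite.of_finite_image (f := c'.edgeTrans c)
      (c.corners.finite_toSet.subset ?_) (hinj.mono inter_subset_left)
    rintro _ ⟨s, hs, rfl⟩; exact hs.2
  set T₁ := T \ (T ∩ c'.edgeTrans c ⁻¹' c.corners) with hT₁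
  have hT₁m : MeasurableSet T₁ := hTm.diff hfin.measurableSet
  have hT₁T : T₁ =ᵐ[volume] T := sdiff_null_ae_eq_self (hfin.measure_zero _)
  have hmem : ∀ s ∈ T₁, s ∈ T ∧ c'.edgeTrans c s ∉ c.corners := fun s hs =>
    ⟨hs.1, fun h => hs.2 ⟨hs.1, h⟩⟩
  have hex : ∀ s, ∃ θ' : ℝ, s ∈ T₁ → HasDerivAt (c'.edgeTrans c) θ' s ∧
      deriv c'.edge s = θ' • deriv c.edge (c'.edgeTrans c s) := by
    intro s
    by_cases hs : s ∈ T₁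
    · obtain ⟨θ', h⟩ := c'.exists_hasDerivAt_edgeTrans c (hmem s hs).1.1 (hmem s hs).1.2.2
        (hmem s hs).2
      exact ⟨θ', fun _ => h⟩
    · exact ⟨0, fun h => absurd h hs⟩
  choose θ' hθ using hex
  have key := lintegral_image_eq_lintegral_abs_deriv_mul hT₁m
    (fun s hs => (hθ s hs).1.hasDerivWithinAt) (hinj.mono sdiff_subset)
    (fun s => ENNReal.ofReal ‖deriv c.edge s‖)
  have hJ : ∫⁻ s in T₁, ENNReal.ofReal ‖deriv c'.edge s‖ =
      ∫⁻ s in T₁, ENNReal.ofReal |θ' s| *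
        ENNReal.ofReal ‖deriv c.edge (c'.edgeTrans c s)‖ := by
    refine setLIntegral_congr_fun hT₁m fun s hs => ?_
    rw [← ENNReal.ofReal_mul (abs_nonneg _), (hθ s hs).2, norm_smul, Real.norm_eq_abs]
  rw [← setLIntegral_congr hT₁T, hJ, ← key]
  refine lintegral_mono_set ?_
  rintro _ ⟨s, hs, rfl⟩
  obtain ⟨hsT, hsc⟩ := hmem s hs
  obtain ⟨h1, h2⟩ := c'.edgeTrans_spec c hsT.1.1 hsT.2.2
  refine ⟨⟨h1, hsc⟩, ?_⟩
  rw [mem_preimage, h2]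
  exact hsT.2.1

theorem boundaryMeasure_restrict_patch (c : LocalParam S) :
    (boundaryMeasure S).restrict c.patch = c.arcLength :=
  restrict_iSup_of_compatible (fun c : LocalParam S => c.measurableSet_patch)
    (fun c => restrict_eq_self_of_compl (c.arcLength_compl c.measurableSet_patch subset_rfl))
    arcLength_restrict_patch_le c

end LocalParam

theorem areaMeasure_compl {S : Set E3} (hS : MeasurableSet S) : areaMeasure S Sᶜ = 0 :=
  iSup_measure_apply_eq_zero hS.compl fun c => c.area_compl hS c.patch_subset

theorem boundaryMeasure_compl {S : Set E3} (hS : MeasurableSet S) : boundaryMeasure S Sᶜ = 0 :=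
  iSup_measure_apply_eq_zero hS.compl fun c => c.arcLength_compl hS c.patch_subset

/-! ### The planar divergence theorem over an epigraph. -/

section PlanarDivergence

open Set Filter Topology

variable {V : Type*} [NormedAddCommGroup V] [NormedSpace ℝ V]

/-- The integral over the real line of the derivative of a compactly supported function,
differentiable off a countable set, vanishes. -/
theorem integral_eq_zero_of_hasDerivAt_off_countable [CompleteSpace V] {f f' : ℝ → V} {s : Set ℝ} (hs : s.Countable)
    (hf : Continuous f) (hd : ∀ x ∉ s, HasDerivAt f (f' x) x) (hi : Integrable f')
    (hsupp : HasCompactSupport f) (hsupp' : HasCompactSupport f') : ∫ x, f' x = 0 := by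
  obtain ⟨R, hR⟩ := (hsupp.union hsupp').isBounded.subset_closedBall 0
  set R' := max R 0 + 1
  have hR' : 0 < R' := by positivity
  have hzero : ∀ x, R' ≤ |x| → f x = 0 ∧ f' x = 0 := by
    intro x hx
    have : x ∉ tsupport f ∪ tsupport f' := by
      intro hx'
      have h1 := hR hx'
      rw [mem_closedBall_zero_iff, Real.norm_eq_abs] at h1
      have : R ≤ max R 0 := le_max_left _ _
      linarith
    exact ⟨image_eq_zero_of_notMem_tsupport fun h => this (Or.inl h),
      image_eq_zero_of_notMem_tsupport fun h => this (Or.inr h)⟩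
  have h1 := integral_eq_of_hasDerivAt_off_countable f f' (a := -R') (b := R') hs hf.continuousOn
    (fun x hx => hd x hx.2) hi.intervalIntegrable
  rw [(hzero R' (le_abs_self _)).1, (hzero (-R') (by rw [abs_neg]; exact le_abs_self _)).1,
    sub_zero] at h1
  rw [← h1, intervalIntegral.integral_eq_integral_of_support_subset]
  intro x hx
  by_contra hx'
  refine hx (hzero x ?_).2
  rw [mem_Ioc, not_and_or, not_lt, not_le] at hx'
  rcases hx' with h | h
  · rw [le_abs]; right; linarith
  · rw [le_abs]; left; exact h.le

/-- The epigraph of a function. -/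
def epi (h : ℝ → ℝ) : Set (ℝ × ℝ) := {x | h x.1 ≤ x.2}

/-- The shear that straightens the graph of a function. -/
def shear (h : ℝ → ℝ) (x : ℝ × ℝ) : ℝ × ℝ := (x.1, x.2 + h x.1)

theorem continuous_shear {h : ℝ → ℝ} (hh : Continuous h) : Continuous (shear h) := by
  unfold shear; fun_prop

theorem measurePreserving_shear {h : ℝ → ℝ} (hh : Continuous h) :
    MeasurePreserving (shear h) volume volume := by
  have := (MeasurePreserving.id (volume : Measure ℝ)).skew_product (g := fun s y => y + h s)
    (μc := (volume : Measure ℝ)) (μd := (volume : Measure ℝ)) (by fun_prop)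
    (Eventually.of_forall fun s => (measurePreserving_add_right volume (h s)).map_eq)
  exact this

/-- The shear as a homeomorphism of the plane. -/
def shearHomeo {h : ℝ → ℝ} (hh : Continuous h) : (ℝ × ℝ) ≃ₜ ℝ × ℝ where
  toFun := shear h
  invFun x := (x.1, x.2 - h x.1)
  left_inv x := by simp [shear]
  right_inv x := by simp [shear]
  continuous_toFun := continuous_shear hh
  continuous_invFun := by fun_prop

theorem shear_preimage_epi (h : ℝ → ℝ) : shear h ⁻¹' epi h = univ ×ˢ Ici 0 := by
  ext x; simp [shear, epi]

theorem setIntegral_epi {h : ℝ → ℝ} (hh : Continuous h) (f : ℝ × ℝ → V) :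
    ∫ x in epi h, f x = ∫ x in univ ×ˢ Ici 0, f (shear h x) := by
  rw [← shear_preimage_epi h]
  exact ((measurePreserving_shear hh).setIntegral_preimage_emb
    (shearHomeo hh).measurableEmbedding f (epi h)).symm

/-- A function which is continuous on a closed set and vanishes off a compact set is integrable there. -/
theorem integrableOn_of_continuousOn_of_compact {X W : Type*} [TopologicalSpace X] [T2Space X]
    [MeasurableSpace X] [OpensMeasurableSpace X] {μ : Measure X} [IsFiniteMeasureOnCompacts μ]
    [NormedAddCommGroup W] {D K : Set X} (hD : IsClosed D) (hK : IsCompact K) {f : X → W}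
    (hf : ContinuousOn f D) (h0 : ∀ x ∈ D, x ∉ K → f x = 0) : IntegrableOn f D μ := by
  have hc : IsCompact (D ∩ K) := hK.inter_left hD
  have h1 : IntegrableOn f (D ∩ K) μ := (hf.mono inter_subset_left).integrableOn_compact hc
  exact h1.of_forall_sdiff_eq_zero hD.measurableSet fun x hx => h0 x hx.1 fun h => hx.2 ⟨hx.1, h⟩

theorem integrableOn_epi_iff {W : Type*} [NormedAddCommGroup W] {h : ℝ → ℝ} (hh : Continuous h)
    (f : ℝ × ℝ → W) :
    IntegrableOn f (epi h) ↔ IntegrableOn (fun x => f (shear h x)) (univ ×ˢ Ici 0) := by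
  rw [← shear_preimage_epi h]
  exact ((measurePreserving_shear hh).integrableOn_comp_preimage
    (shearHomeo hh).measurableEmbedding).symm

theorem isClosed_epi {h : ℝ → ℝ} (hh : Continuous h) : IsClosed (epi h) := isClosed_epigraph hh

theorem uniqueDiffOn_epi {h : ℝ → ℝ} {K : NNReal} (hh : LipschitzWith K h) :
    UniqueDiffOn ℝ (epi h) := uniqueDiffOn_epigraph hh

theorem epi_mem_nhds {h : ℝ → ℝ} (hh : Continuous h) {x : ℝ × ℝ} (hx : h x.1 < x.2) :
    epi h ∈ 𝓝 x := by
  filter_upwards [(isOpen_lt (hh.comp continuous_fst) continuous_snd).mem_nhds hx] with z hz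
  exact (show h z.1 < z.2 from hz).le

variable {h : ℝ → ℝ} {K : NNReal} {F : ℝ × ℝ → V} {Z : Set (ℝ × ℝ)}

theorem fderivWithin_epi_eq_zero (hZ : IsCompact Z) (h0 : ∀ x ∈ epi h, x ∉ Z → F x = 0)
    {x : ℝ × ℝ} (hx : x ∈ epi h) (hxZ : x ∉ Z) : fderivWithin ℝ F (epi h) x = 0 := by
  have heq : F =ᶠ[𝓝[epi h] x] fun _ => 0 := by
    filter_upwards [self_mem_nhdsWithin, mem_nhdsWithin_of_mem_nhds
      (hZ.isClosed.isOpen_compl.mem_nhds hxZ)] with z hz hz' using h0 z hz hz'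
  rw [heq.fderivWithin_eq (h0 x hx hxZ)]
  simp

theorem continuousOn_fderivWithin_epi (hh : LipschitzWith K h) (hF : ContDiffOn ℝ 1 F (epi h)) :
    ContinuousOn (fderivWithin ℝ F (epi h)) (epi h) :=
  hF.continuousOn_fderivWithin (uniqueDiffOn_epi hh) le_rfl

/-- The weight will be `1` or `h'`; the latter is only measurable and bounded by the Lipschitz
constant. -/
theorem integrableOn_weight_smul_fderivWithin (hh : LipschitzWith K h)
    (hF : ContDiffOn ℝ 1 F (epi h)) (hZ : IsCompact Z) (h0 : ∀ x ∈ epi h, x ∉ Z → F x = 0)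
    {w : ℝ → ℝ} (hw : Measurable w) {C : ℝ} (hC : ∀ s, ‖w s‖ ≤ C) (v : ℝ × ℝ) :
    IntegrableOn (fun x => w x.1 • fderivWithin ℝ F (epi h) x v) (epi h) := by
  have h1 : IntegrableOn (fun x => fderivWithin ℝ F (epi h) x v) (epi h) :=
    integrableOn_of_continuousOn_of_compact (isClosed_epi hh.continuous) hZ
      ((continuousOn_fderivWithin_epi hh hF).clm_apply continuousOn_const)
      fun x hx hxZ => by rw [fderivWithin_epi_eq_zero hZ h0 hx hxZ]; rfl
  exact h1.bdd_smul C (hw.comp measurable_fst).aestronglyMeasurable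
    (Eventually.of_forall fun x => hC x.1)

theorem hasFDerivAt_of_lt (hh : LipschitzWith K h) (hF : ContDiffOn ℝ 1 F (epi h))
    {x : ℝ × ℝ} (hx : h x.1 < x.2) : HasFDerivAt F (fderivWithin ℝ F (epi h) x) x :=
  ((hF.differentiableOn one_ne_zero) x hx.le).hasFDerivWithinAt.hasFDerivAt
    (epi_mem_nhds hh.continuous hx)

/-- Integration of a vertical derivative over an epigraph. -/
theorem integral_epi_vertical [CompleteSpace V] (hh : LipschitzWith K h)
    (hF : ContDiffOn ℝ 1 F (epi h)) (hZ : IsCompact Z) (h0 : ∀ x ∈ epi h, x ∉ Z → F x = 0)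
    {w : ℝ → ℝ} (hw : Measurable w) {C : ℝ} (hC : ∀ s, ‖w s‖ ≤ C) :
    ∫ x in epi h, w x.1 • fderivWithin ℝ F (epi h) x (0, 1) = -∫ s, w s • F (s, h s) := by
  have hi := integrableOn_weight_smul_fderivWithin hh hF hZ h0 hw hC (0, 1)
  rw [integrableOn_epi_iff hh.continuous, IntegrableOn, Measure.volume_eq_prod,
    ← Measure.prod_restrict] at hi
  rw [setIntegral_epi hh.continuous, Measure.volume_eq_prod, ← Measure.prod_restrict,
    integral_prod _ hi, Measure.restrict_univ, ← integral_neg]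
  refine integral_congr_ae (Eventually.of_forall fun s => ?_)
  simp only [shear]
  rw [integral_smul, integral_Ici_eq_integral_Ioi, ← smul_neg]
  congr 1
  have hmem : ∀ y ∈ Ici (0 : ℝ), (s, y + h s) ∈ epi h := fun y hy => by
    change h s ≤ y + h s
    linarith [mem_Ici.1 hy]
  have hZ' : IsCompact ((fun x : ℝ × ℝ => x.2 - h s) '' Z) := hZ.image (by fun_prop)
  have hnot : ∀ y, y ∉ ((fun x : ℝ × ℝ => x.2 - h s) '' Z) → (s, y + h s) ∉ Z := fun y hy hyZ =>
    hy ⟨_, hyZ, by simp⟩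
  have hcurve : Continuous fun y : ℝ => (s, y + h s) := by fun_prop
  -- On each vertical line the weight is constant; the fundamental theorem of calculus runs from the
  -- graph up to heights where `F` vanishes.
  have key := integral_Ioi_of_hasDerivAt_of_tendsto (a := 0) (m := (0 : V))
    (f := fun y => F (s, y + h s)) (f' := fun y => fderivWithin ℝ F (epi h) (s, y + h s) (0, 1))
    ((hF.continuousOn.comp hcurve.continuousOn hmem) 0 self_mem_Ici)
    (fun y hy => by
      have h1 := hasFDerivAt_of_lt hh hF (x := (s, y + h s)) (by
        change h s < y + h s; linarith [mem_Ioi.1 hy])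
      have h2 : HasDerivAt (fun y : ℝ => (s, y + h s)) ((0 : ℝ), (1 : ℝ)) y :=
        (hasDerivAt_const y s).prodMk ((hasDerivAt_id y).add_const _)
      exact h1.comp_hasDerivAt y h2)
    ((integrableOn_of_continuousOn_of_compact isClosed_Ici hZ'
      (((continuousOn_fderivWithin_epi hh hF).comp hcurve.continuousOn hmem).clm_apply
        continuousOn_const) (fun y hy hyZ => by
          simp only [Function.comp_apply]
          rw [fderivWithin_epi_eq_zero hZ h0 (hmem y hy) (hnot y hyZ)]; rfl)).mono_set
      Ioi_subset_Ici_self)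
    (by
      obtain ⟨R, hR⟩ := hZ'.bddAbove
      refine tendsto_const_nhds.congr' ?_
      filter_upwards [eventually_gt_atTop R, eventually_ge_atTop 0] with y hy hy0
      exact (h0 _ (hmem y hy0) (hnot y fun hyZ => absurd (hR hyZ) (not_le.2 hy))).symm)
  simpa using key

/-- The integral over an epigraph of the derivative along the boundary vanishes. -/
theorem integral_epi_tangential [CompleteSpace V] (hh : LipschitzWith K h) {cs : Set ℝ}
    (hcs : cs.Countable) (hd : ∀ s ∉ cs, DifferentiableAt ℝ h s)
    (hF : ContDiffOn ℝ 1 F (epi h)) (hZ : IsCompact Z) (h0 : ∀ x ∈ epi h, x ∉ Z → F x = 0) :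
    ∫ x in epi h, (fderivWithin ℝ F (epi h) x (1, 0) +
      deriv h x.1 • fderivWithin ℝ F (epi h) x (0, 1)) = 0 := by
  have hi1 := integrableOn_weight_smul_fderivWithin hh hF hZ h0
    (measurable_const (a := (1 : ℝ))) (C := 1) (by simp) (1, 0)
  have hi2 := integrableOn_weight_smul_fderivWithin hh hF hZ h0
    (measurable_deriv h) (fun s => norm_deriv_le_of_lipschitz hh) (0, 1)
  have hi := hi1.add hi2
  simp only [one_smul] at hi
  rw [integrableOn_epi_iff hh.continuous, IntegrableOn, Measure.volume_eq_prod,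
    ← Measure.prod_restrict] at hi
  change ∫ x in epi h, ((fun x => fderivWithin ℝ F (epi h) x (1, 0)) +
    fun x : ℝ × ℝ => deriv h x.1 • fderivWithin ℝ F (epi h) x (0, 1)) x = 0
  rw [setIntegral_epi hh.continuous, Measure.volume_eq_prod, ← Measure.prod_restrict,
    integral_prod_symm _ hi, Measure.restrict_univ, integral_Ici_eq_integral_Ioi]
  -- After the shear, the integrand at height `y` is the derivative of `s ↦ F (s, y + h s)`. For `y
  -- > 0` this curve stays in the interior, where `F` is differentiable; the line `y = 0` was
  -- dropped as a null set.
  refine setIntegral_eq_zero_of_forall_eq_zero fun y hy => ?_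
  rw [mem_Ioi] at hy
  simp only [shear, Pi.add_apply]
  have hmem : ∀ s, (s, y + h s) ∈ epi h := fun s => by
    change h s ≤ y + h s
    linarith
  have hcurve : Continuous fun s : ℝ => (s, y + h s) := by
    have := hh.continuous
    fun_prop
  have hZ' : IsCompact (Prod.fst '' Z) := hZ.image continuous_fst
  have hnot : ∀ s, s ∉ Prod.fst '' Z → (s, y + h s) ∉ Z := fun s hs hsZ => hs ⟨_, hsZ, rfl⟩
  have hA0 : ∀ s, s ∉ Prod.fst '' Z → fderivWithin ℝ F (epi h) (s, y + h s) = 0 := fun s hs =>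
    fderivWithin_epi_eq_zero hZ h0 (hmem s) (hnot s hs)
  have hAi : ∀ v, Integrable fun s => fderivWithin ℝ F (epi h) (s, y + h s) v := by
    intro v
    rw [← integrableOn_univ]
    exact integrableOn_of_continuousOn_of_compact isClosed_univ hZ'
      (((continuousOn_fderivWithin_epi hh hF).comp hcurve.continuousOn fun s _ => hmem s).clm_apply
        continuousOn_const) (fun s _ hs => by simp [hA0 s hs])
  refine integral_eq_zero_of_hasDerivAt_off_countable (f := fun s => F (s, y + h s)) hcs ?_ ?_ ?_
    ?_ ?_
  · rw [← continuousOn_univ]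
    exact hF.continuousOn.comp hcurve.continuousOn fun s _ => hmem s
  · intro s hs
    have h1 := hasFDerivAt_of_lt hh hF (x := (s, y + h s)) (by
        change h s < y + h s; linarith)
    have h2 : HasDerivAt (fun s : ℝ => (s, y + h s)) ((1 : ℝ), deriv h s) s :=
      (hasDerivAt_id s).prodMk ((hd s hs).hasDerivAt.const_add y)
    have h3 := h1.comp_hasDerivAt s h2
    have h4 : ((1 : ℝ), deriv h s) = (1, 0) + deriv h s • (0, 1) := by ext <;> simp
    rw [h4, map_add, map_smul] at h3
    exact h3
  · exact (hAi _).add ((hAi _).bdd_smul K (measurable_deriv h).aestronglyMeasurable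
      (Eventually.of_forall fun s => norm_deriv_le_of_lipschitz hh))
  · exact HasCompactSupport.intro hZ' fun s hs => h0 _ (hmem s) (hnot s hs)
  · exact HasCompactSupport.intro hZ' fun s hs => by simp [hA0 s hs]

/-- The divergence theorem on the epigraph of a Lipschitz function. -/
theorem integral_epi_divergence [CompleteSpace V] (hh : LipschitzWith K h) {cs : Set ℝ}
    (hcs : cs.Countable) (hd : ∀ s ∉ cs, DifferentiableAt ℝ h s) {G : ℝ × ℝ → V}
    (hF : ContDiffOn ℝ 1 F (epi h)) (hG : ContDiffOn ℝ 1 G (epi h)) (hZ : IsCompact Z)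
    (hF0 : ∀ x ∈ epi h, x ∉ Z → F x = 0) (hG0 : ∀ x ∈ epi h, x ∉ Z → G x = 0) :
    IntegrableOn (fun x => fderivWithin ℝ F (epi h) x (1, 0) + fderivWithin ℝ G (epi h) x (0, 1))
      (epi h) ∧ Integrable (fun s => deriv h s • F (s, h s) - G (s, h s)) ∧
    ∫ x in epi h, (fderivWithin ℝ F (epi h) x (1, 0) + fderivWithin ℝ G (epi h) x (0, 1)) =
      ∫ s, (deriv h s • F (s, h s) - G (s, h s)) := by
  have h1 : ∀ s : ℝ, ‖(1 : ℝ)‖ ≤ 1 := by simp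
  have hK : ∀ s, ‖deriv h s‖ ≤ K := fun s => norm_deriv_le_of_lipschitz hh
  have hm1 : Measurable fun _ : ℝ => (1 : ℝ) := measurable_const
  have hF1 := integrableOn_weight_smul_fderivWithin hh hF hZ hF0 hm1 h1 (1, 0)
  have hG2 := integrableOn_weight_smul_fderivWithin hh hG hZ hG0 hm1 h1 (0, 1)
  have hF2 := integrableOn_weight_smul_fderivWithin hh hF hZ hF0 (measurable_deriv h) hK (0, 1)
  have eF := integral_epi_vertical hh hF hZ hF0 (measurable_deriv h) hK
  have eG := integral_epi_vertical hh hG hZ hG0 hm1 h1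
  have eT := integral_epi_tangential hh hcs hd hF hZ hF0
  simp only [one_smul] at hF1 hG2 eG
  have hgraph : Continuous fun s => (s, h s) := continuous_id.prodMk hh.continuous
  have hZ' : IsCompact (Prod.fst '' Z) := hZ.image continuous_fst
  have hb : ∀ {H : ℝ × ℝ → V}, ContDiffOn ℝ 1 H (epi h) → (∀ x ∈ epi h, x ∉ Z → H x = 0) →
      Integrable fun s => H (s, h s) := by
    intro H hH hH0
    rw [← integrableOn_univ]
    exact integrableOn_of_continuousOn_of_compact isClosed_univ hZ'
      (hH.continuousOn.comp hgraph.continuousOn fun s _ => le_refl (h s))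
      fun s _ hs => hH0 _ (le_refl (h s)) fun hsZ => hs ⟨_, hsZ, rfl⟩
  have hbF : Integrable fun s => deriv h s • F (s, h s) :=
    (hb hF hF0).bdd_smul K (measurable_deriv h).aestronglyMeasurable (Eventually.of_forall hK)
  refine ⟨hF1.add hG2, hbF.sub (hb hG hG0), ?_⟩
  -- The vanishing tangential integral trades the horizontal derivative of `F` for a vertical one
  -- with weight `-h'`, already evaluated in `eF`.
  rw [integral_add hF1 hF2, eF] at eT
  rw [integral_add hF1 hG2, integral_sub hbF (hb hG hG0), eG, ← sub_eq_add_neg]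
  congr 1
  rwa [← sub_eq_add_neg, sub_eq_zero] at eT

end PlanarDivergence

/-! ### Coordinate normal, mean curvature and conormal fields. -/

theorem eq_inner_smul_normal2 {g : Fin 2 → E3} (hg : LinearIndependent ℝ g) {v : E3}
    (hv : ∀ i, inner ℝ v (g i) = 0) : v = (inner ℝ (normal2 g) v : ℝ) • normal2 g := by
  have h1 : cross v (normal2 g) = 0 := by
    rw [normal2, cross_smul_right, cross_cross_right, hv, hv]; simp
  have h2 := cross_cross_right (normal2 g) v (normal2 g)
  have h3 : cross (normal2 g) (0 : E3) = 0 := (crossL _).map_zero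
  rw [h1, h3, real_inner_self_eq_norm_sq, norm_normal2 hg, one_pow, one_smul] at h2
  exact sub_eq_zero.1 h2.symm

/-- The inner product as a continuous bilinear map. -/
noncomputable def innerL : E3 →L[ℝ] E3 →L[ℝ] ℝ :=
  (isBoundedBilinearMap_inner (𝕜 := ℝ) (E := E3)).toContinuousLinearMap

theorem innerL_apply (u v : E3) : innerL u v = inner ℝ u v := rfl

namespace LocalParam

open Set Filter Topology

variable {S : Set E3} (c : LocalParam S)

/-- The unit normal that is determined by the orientation of the parameter plane. -/
noncomputable def normal (x : ℝ × ℝ) : E3 := normal2 fun i => c.g i x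

theorem contDiffAt_g (i : Fin 2) {x : ℝ × ℝ} (hx : x ∈ c.U) : ContDiffAt ℝ 1 (c.g i) x :=
  (c.contDiffOn_g i).contDiffAt (c.isOpen_U.mem_nhds hx)

theorem contDiffAt_normal {x : ℝ × ℝ} (hx : x ∈ c.dom) : ContDiffAt ℝ 1 c.normal x := by
  have h1 : ContDiffAt ℝ 1 (fun x => cross (c.g 0 x) (c.g 1 x)) x :=
    c.contDiffOn_cross_g.contDiffAt (c.isOpen_U.mem_nhds hx.1)
  have h0 : cross (c.g 0 x) (c.g 1 x) ≠ 0 := cross_ne_zero (c.linearIndependent_g hx)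
  exact ((h1.norm ℝ h0).inv (norm_ne_zero_iff.2 h0)).smul h1

variable {n : E3 → E3}

theorem eq_smul_normal (hn : IsUnitNormal S n) {x : ℝ × ℝ} (hx : x ∈ c.dom) :
    n (c.map x) = (inner ℝ (c.normal x) (n (c.map x)) : ℝ) • c.normal x :=
  eq_inner_smul_normal2 (c.linearIndependent_g hx) fun i => (hn.2 c x hx).2 i

theorem norm_normal {x : ℝ × ℝ} (hx : x ∈ c.dom) : ‖c.normal x‖ = 1 :=
  norm_normal2 (c.linearIndependent_g hx)

theorem inner_normal_sq (hn : IsUnitNormal S n) {x : ℝ × ℝ} (hx : x ∈ c.dom) :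
    (inner ℝ (c.normal x) (n (c.map x)) : ℝ) * inner ℝ (c.normal x) (n (c.map x)) = 1 := by
  have h1 := congrArg norm (c.eq_smul_normal hn hx)
  rw [norm_smul, (hn.2 c x hx).1, c.norm_normal hx, mul_one, Real.norm_eq_abs] at h1
  rw [← abs_mul_abs_self, ← h1, one_mul]

/-- A continuous unit normal field is locally the coordinate normal up to a constant sign. -/
theorem exists_sign (hn : IsUnitNormal S n) {x : ℝ × ℝ} (hx : x ∈ c.dom) :
    ∃ ε : ℝ, ε * ε = 1 ∧ n (c.map x) = ε • c.normal x ∧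
      n ∘ c.map =ᶠ[𝓝[c.dom] x] fun z => ε • c.normal z := by
  set σ : ℝ × ℝ → ℝ := fun z => inner ℝ (c.normal z) (n (c.map z)) with hσ
  have hcont : ContinuousWithinAt σ c.dom x := by
    refine ContinuousWithinAt.inner (𝕜 := ℝ) (c.contDiffAt_normal hx).continuousAt.continuousWithinAt
      ?_
    exact (hn.1 _ (c.map_mem hx)).comp (c.continuousOn_map x hx) fun z hz => c.map_mem hz
  refine ⟨σ x, c.inner_normal_sq hn hx, c.eq_smul_normal hn hx, ?_⟩
  filter_upwards [hcont (Metric.ball_mem_nhds (σ x) one_pos), self_mem_nhdsWithin] with z hz hzd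
  -- Both values are `±1` and differ by less than one.
  have h1 : σ z = σ x := by
    rw [mem_preimage, Metric.mem_ball, Real.dist_eq, abs_lt] at hz
    have e1 := mul_self_eq_one_iff.1 (c.inner_normal_sq hn hx)
    have e2 := mul_self_eq_one_iff.1 (c.inner_normal_sq hn hzd)
    change σ x = 1 ∨ σ x = -1 at e1
    change σ z = 1 ∨ σ z = -1 at e2
    rcases e1 with e1 | e1 <;> rcases e2 with e2 | e2 <;> rw [e1, e2] at hz ⊢ <;>
      norm_num at hz
  rw [← h1]
  exact c.eq_smul_normal hn hzd

/-- Only continuity of `n` is assumed; it inherits differentiability from the coordinate normal,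
which it equals locally up to a constant sign. -/
theorem contDiffWithinAt_normal_field (hn : IsUnitNormal S n) {x : ℝ × ℝ} (hx : x ∈ c.dom) :
    ContDiffWithinAt ℝ 1 (n ∘ c.map) c.dom x := by
  obtain ⟨ε, -, h1, h2⟩ := c.exists_sign hn hx
  have h3 : ContDiffWithinAt ℝ 1 (fun z => ε • c.normal z) c.dom x :=
    (c.contDiffAt_normal hx).contDiffWithinAt.const_smul ε
  exact h3.congr_of_eventuallyEq h2 h1

/-- Differentiating `(g_i, n) = 0` gives `b_ij = -(g_i, ∂n/∂xʲ)`. This exhibits `H` as a contraction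
of the first derivatives of `n`, hence independent of the chart. -/
theorem meanCurv_eq (hn : IsUnitNormal S n) {x : ℝ × ℝ} (hx : x ∈ c.dom) :
    c.meanCurv n x = -contraction innerL n c x := by
  have hN := ((c.contDiffWithinAt_normal_field hn hx).differentiableWithinAt
    one_ne_zero).hasFDerivWithinAt
  have hb : ∀ i j, c.curv n x i j =
      -inner ℝ (c.g i x) (fderivWithin ℝ (n ∘ c.map) c.dom x (coordDir j)) := by
    intro i j
    have hg := ((c.contDiffAt_g i hx.1).differentiableAt one_ne_zero).hasFDerivAt.hasFDerivWithinAt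
      (s := c.dom)
    have h1 := hg.inner ℝ hN
    have h2 : HasFDerivWithinAt (fun z => (inner ℝ (c.g i z) ((n ∘ c.map) z) : ℝ))
        (0 : ℝ × ℝ →L[ℝ] ℝ) c.dom x := by
      refine (hasFDerivWithinAt_const (0 : ℝ) x c.dom).congr (fun z hz => ?_) ?_
      · rw [real_inner_comm]; exact (hn.2 c z hz).2 i
      · rw [real_inner_comm]; exact (hn.2 c x hx).2 i
    have h3 := congrArg (fun L : ℝ × ℝ →L[ℝ] ℝ => L (coordDir j))
      ((c.uniqueDiffOn_dom x hx).eq h1 h2)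
    simp [fderivInnerCLM_apply] at h3
    rw [curv]
    linarith
  simp only [meanCurv, contraction, hb, innerL_apply, gDual, sum_inner, real_inner_smul_left,
    mul_neg, Finset.sum_neg_distrib]
  rw [Finset.sum_comm]
  congr 1
  refine Finset.sum_congr rfl fun j _ => Finset.sum_congr rfl fun i _ => ?_
  rw [c.metric_eq, gram2_inv_symm]

theorem meanCurvature_map (hn : IsUnitNormal S n) {x : ℝ × ℝ} (hx : x ∈ c.dom) :
    meanCurvature S n (c.map x) = c.meanCurv n x := by
  refine atPoint_eq (fun c c' x hx x' hx' h => ?_) c hx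
  rw [c.meanCurv_eq hn hx, c'.meanCurv_eq hn hx', contraction_eq_of_map_eq innerL hx hx' h
    ((c'.contDiffWithinAt_normal_field hn hx').differentiableWithinAt one_ne_zero)]

/-- The conormal coefficient fields `√g g^l`. -/
noncomputable def conormal (l : Fin 2) (x : ℝ × ℝ) : E3 :=
  if l = 0 then cross (c.g 1 x) (c.normal x) else cross (c.normal x) (c.g 0 x)

theorem conormal_zero : c.conormal 0 = fun x => crossL (c.g 1 x) (c.normal x) := by
  ext1 x; simp [conormal, crossL_apply]

theorem conormal_one : c.conormal 1 = fun x => crossL (c.normal x) (c.g 0 x) := by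
  ext1 x; simp [conormal, crossL_apply]

theorem conormal_eq {x : ℝ × ℝ} (hx : x ∈ c.dom) (l : Fin 2) :
    c.conormal l x = Real.sqrt (c.metric x).det • c.gDual l x := by
  rw [c.sqrt_det_metric]
  fin_cases l
  · exact (smul_dual2_zero (c.linearIndependent_g hx)).symm
  · exact (smul_dual2_one (c.linearIndependent_g hx)).symm

theorem contDiffAt_conormal (l : Fin 2) {x : ℝ × ℝ} (hx : x ∈ c.dom) :
    ContDiffAt ℝ 1 (c.conormal l) x := by
  fin_cases l
  · simp only [Fin.zero_eta, conormal_zero]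
    exact (crossL.contDiff.contDiffAt.comp x (c.contDiffAt_g 1 hx.1)).clm_apply
      (c.contDiffAt_normal hx)
  · simp only [Fin.mk_one, conormal_one]
    exact (crossL.contDiff.contDiffAt.comp x (c.contDiffAt_normal hx)).clm_apply
      (c.contDiffAt_g 0 hx.1)

theorem fderiv_g_symm {x : ℝ × ℝ} (hx : x ∈ c.U) (i j : Fin 2) :
    fderiv ℝ (c.g i) x (coordDir j) = fderiv ℝ (c.g j) x (coordDir i) := by
  have hd : DifferentiableAt ℝ (fderiv ℝ c.map) x :=
    ((c.contDiffAt_map hx).fderiv_right (m := 1) (by norm_num)).differentiableAt one_ne_zero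
  have h : ∀ i j, fderiv ℝ (c.g i) x (coordDir j) =
      fderiv ℝ (fderiv ℝ c.map) x (coordDir j) (coordDir i) := by
    intro i j
    have := hd.hasFDerivAt.clm_apply (hasFDerivAt_const (coordDir i) x)
    have e : fderiv ℝ (c.g i) x = _ := this.fderiv
    rw [e]; simp
  rw [h, h]
  exact ((c.contDiffAt_map hx).isSymmSndFDerivAt (by simp)) _ _

/-- The divergence of the conormal coefficient fields is the mean curvature vector. -/
theorem divergence_conormal (hn : IsUnitNormal S n) {x : ℝ × ℝ} (hx : x ∈ c.dom) :
    fderiv ℝ (c.conormal 0) x (coordDir 0) + fderiv ℝ (c.conormal 1) x (coordDir 1) =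
      Real.sqrt (c.metric x).det • c.meanCurv n x • n (c.map x) := by
  have hN := ((c.contDiffAt_normal hx).differentiableAt one_ne_zero).hasFDerivAt
  have hg := fun i => ((c.contDiffAt_g i hx.1).differentiableAt one_ne_zero).hasFDerivAt
  set w : Fin 2 → E3 := fun l => fderiv ℝ c.normal x (coordDir l) with hw
  have h0 : fderiv ℝ (c.conormal 0) x (coordDir 0) =
      cross (fderiv ℝ (c.g 1) x (coordDir 0)) (c.normal x) + cross (c.g 1 x) (w 0) := by
    have := (crossL.hasFDerivAt.comp x (hg 1)).clm_apply hN
    have e : fderiv ℝ (fun x => crossL (c.g 1 x) (c.normal x)) x = _ := this.fderiv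
    rw [conormal_zero, e]; simp [crossL_apply, hw, add_comm]
  have h1 : fderiv ℝ (c.conormal 1) x (coordDir 1) =
      cross (w 1) (c.g 0 x) + cross (c.normal x) (fderiv ℝ (c.g 0) x (coordDir 1)) := by
    have := (crossL.hasFDerivAt.comp x hN).clm_apply (hg 0)
    have e : fderiv ℝ (fun x => crossL (c.normal x) (c.g 0 x)) x = _ := this.fderiv
    rw [conormal_one, e]; simp [crossL_apply, hw, add_comm]
  -- Differentiating `|N|² = 1` shows that the derivatives of the normal are tangent.
  have hwN : ∀ i, inner ℝ (w i) (c.normal x) = 0 := by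
    intro i
    have h2 := (hN.inner ℝ hN).hasFDerivWithinAt (s := c.dom)
    have h3 : HasFDerivWithinAt (fun z => (inner ℝ (c.normal z) (c.normal z) : ℝ))
        (0 : ℝ × ℝ →L[ℝ] ℝ) c.dom x := by
      refine (hasFDerivWithinAt_const (1 : ℝ) x c.dom).congr (fun z hz => ?_) ?_
      · rw [real_inner_self_eq_norm_sq, c.norm_normal hz, one_pow]
      · rw [real_inner_self_eq_norm_sq, c.norm_normal hx, one_pow]
    have h4 := congrArg (fun L : ℝ × ℝ →L[ℝ] ℝ => L (coordDir i))
      ((c.uniqueDiffOn_dom x hx).eq h2 h3)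
    simp [fderivInnerCLM_apply] at h4
    rw [real_inner_comm] at h4
    have h5 : inner ℝ (w i) (c.normal x) + inner ℝ (w i) (c.normal x) = 0 := h4
    linarith
  obtain ⟨ε, hε, hnx, heq⟩ := c.exists_sign hn hx
  have hH : c.meanCurv n x = -(ε * ∑ l, inner ℝ (c.gDual l x) (w l)) := by
    rw [c.meanCurv_eq hn hx, contraction, Finset.mul_sum]
    congr 1
    refine Finset.sum_congr rfl fun l _ => ?_
    have h5 : HasFDerivWithinAt (n ∘ c.map) (ε • fderiv ℝ c.normal x) c.dom x :=
      (hN.const_smul ε).hasFDerivWithinAt.congr_of_eventuallyEq heq hnx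
    rw [h5.fderivWithin (c.uniqueDiffOn_dom x hx), innerL_apply]
    simp [hw, real_inner_smul_right]
  -- By symmetry of second derivatives the two terms containing `∂₀g₁ = ∂₁g₀` become opposite.
  rw [h0, h1, c.fderiv_g_symm hx.1 1 0, cross_swap _ (c.normal x)]
  have key := cross_add_cross_eq (w := w) (c.linearIndependent_g hx) hwN
  have e : -cross (c.normal x) (fderiv ℝ (c.g 0) x (coordDir 1)) + cross (c.g 1 x) (w 0) +
      (cross (w 1) (c.g 0 x) + cross (c.normal x) (fderiv ℝ (c.g 0) x (coordDir 1))) =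
      cross (c.g 1 x) (w 0) + cross (w 1) (c.g 0 x) := by abel
  rw [e, key, hnx, hH, c.sqrt_det_metric, smul_smul, smul_smul]
  change _ • c.normal x = _
  congr 1
  change -(‖cross (c.g 0 x) (c.g 1 x)‖ * ∑ l, inner ℝ (c.gDual l x) (w l)) = _
  linear_combination (‖cross (c.g 0 x) (c.g 1 x)‖ * ∑ l, inner ℝ (c.gDual l x) (w l)) * hε

/-- The exterior conormal of the boundary curve in coordinates. -/
theorem norm_smul_cross_tangent {τ : E3 → E3} (hn : IsUnitNormal S n)
    (hτ : IsPositiveTangent S n τ) {s : ℝ} (hs : s ∈ c.edgeDom) :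
    ‖deriv c.edge s‖ • cross (τ (c.edge s)) (n (c.edge s)) =
      deriv c.h s • c.conormal 0 (s, c.h s) - c.conormal 1 (s, c.h s) := by
  have hx := c.edge_mem_dom hs.1
  obtain ⟨h1, h2, h3⟩ := hτ c s hs
  obtain ⟨t, ht⟩ := Submodule.mem_span_singleton.1 h2
  obtain ⟨ε, hε, hnx, -⟩ := c.exists_sign hn hx
  change n (c.edge s) = _ at hnx
  set e := deriv c.edge s with he
  set N := c.normal (s, c.h s) with hN
  have hgN : e = c.g 0 (s, c.h s) + deriv c.h s • c.g 1 (s, c.h s) := c.deriv_edge hs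
  have hcross : cross (τ (c.edge s)) (n (c.edge s)) = (t * ε) • cross e N := by
    rw [← ht, hnx, cross_smul_left, cross_smul_right, smul_smul]
  have hrhs : deriv c.h s • c.conormal 0 (s, c.h s) - c.conormal 1 (s, c.h s) = cross e N := by
    rw [hgN, cross_add_left, cross_smul_left, conormal_zero, conormal_one]
    simp only [crossL_apply]
    rw [cross_swap (c.normal _) (c.g 0 _), sub_neg_eq_add, add_comm]
  have hJ : 0 < ‖cross (c.g 0 (s, c.h s)) (c.g 1 (s, c.h s))‖ :=
    norm_pos_iff.2 (cross_ne_zero (c.linearIndependent_g hx))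
  -- The `h'` component of `e` is parallel to `g 1` and drops out. The negative value identifies `e
  -- × N` as the outward direction, so the orientation of `τ` forces `t * ε > 0`.
  have hin : inner ℝ (cross e N) (c.g 1 (s, c.h s)) =
      -‖cross (c.g 0 (s, c.h s)) (c.g 1 (s, c.h s))‖ := by
    have e1 : cross (c.g 0 (s, c.h s)) (c.g 1 (s, c.h s)) =
      ‖cross (c.g 0 (s, c.h s)) (c.g 1 (s, c.h s))‖ • N :=
      cross_eq_smul_normal2 (c.linearIndependent_g hx)
    have e2 : inner ℝ (cross (c.g 0 (s, c.h s)) (c.g 1 (s, c.h s))) N =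
        ‖cross (c.g 0 (s, c.h s)) (c.g 1 (s, c.h s))‖ := by
      conv_lhs => rw [e1]
      rw [real_inner_smul_left, real_inner_self_eq_norm_sq, c.norm_normal hx]; simp
    rw [← e2, hgN]
    simp only [inner_E3, cross_apply_zero, cross_apply_one, cross_apply_two, PiLp.add_apply,
      PiLp.smul_apply, smul_eq_mul]
    ring
  rw [hcross, real_inner_smul_left, hin] at h3
  have hpos : 0 < t * ε := by
    by_contra hle
    have := mul_nonneg_of_nonpos_of_nonpos (not_lt.1 hle) (neg_nonpos.2 hJ.le)
    linarith
  have hnorm : |t| * ‖e‖ = 1 := by rw [← Real.norm_eq_abs, ← norm_smul, ht, h1]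
  have habs : t * ε = |t| := by
    rw [← abs_of_pos hpos, abs_mul]
    have : |ε| = 1 := by
      rcases mul_self_eq_one_iff.1 hε with h | h <;> simp [h]
    rw [this, mul_one]
  rw [hrhs, hcross, smul_smul, habs, mul_comm, hnorm, one_smul]

end LocalParam

/-! ### The formula in one chart. -/

namespace LocalParam

open Set Filter Topology

variable {S : Set E3} (c : LocalParam S)

theorem dom_mem_nhdsWithin_epi {x : ℝ × ℝ} (hx : x ∈ c.dom) : c.dom ∈ 𝓝[epi c.h] x := by
  have : c.dom = c.U ∩ epi c.h := rfl
  rw [this]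
  exact inter_mem (mem_nhdsWithin_of_mem_nhds (c.isOpen_U.mem_nhds hx.1)) self_mem_nhdsWithin

/-- `S ∩ Z` is compact and lies in the image of an embedding, so its preimage is compact. This makes
the fluxes compactly supported in the plane. -/
theorem isCompact_dom_inter_preimage (hS : IsCompact S) {Z : Set E3} (hZ : IsClosed Z)
    (hZS : S ∩ Z ⊆ c.patch) : IsCompact (c.dom ∩ c.map ⁻¹' Z) := by
  have hK : IsCompact (S ∩ Z) := hS.inter_right hZ
  have h1 := c.isEmbedding.isInducing.isCompact_preimage' hK (by
    rw [range_domRestrict]; exact hZS)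
  have h2 := h1.image continuous_subtype_val
  convert h2 using 1
  ext x
  constructor
  · rintro ⟨hx, hxZ⟩
    exact ⟨⟨x, hx⟩, ⟨c.map_mem hx, hxZ⟩, rfl⟩
  · rintro ⟨⟨y, hy⟩, hyZ, rfl⟩
    exact ⟨hy, hyZ.2⟩

variable {V W : Type*} [NormedAddCommGroup V] [NormedSpace ℝ V] [NormedAddCommGroup W]
  [NormedSpace ℝ W] {n : E3 → E3} {Φ : E3 → V} {Z : Set E3}

/-- The fields `√g g^l ∘ Φ`, extended by zero. -/
noncomputable def flux (op : E3 →L[ℝ] V →L[ℝ] W) (Φ : E3 → V) (l : Fin 2) : ℝ × ℝ → W :=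
  c.dom.indicator fun x => op (c.conormal l x) (Φ (c.map x))

theorem flux_of_mem (op : E3 →L[ℝ] V →L[ℝ] W) (l : Fin 2) {x : ℝ × ℝ} (hx : x ∈ c.dom) :
    c.flux op Φ l x = op (c.conormal l x) (Φ (c.map x)) := indicator_of_mem hx _

theorem flux_eq_zero (op : E3 →L[ℝ] V →L[ℝ] W) (l : Fin 2) (h0 : ∀ y ∈ S, y ∉ Z → Φ y = 0)
    {x : ℝ × ℝ} (hx : x ∉ c.dom ∩ c.map ⁻¹' Z) : c.flux op Φ l x = 0 := by
  by_cases hd : x ∈ c.dom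
  · rw [c.flux_of_mem op l hd, h0 _ (c.map_mem hd) fun hZ => hx ⟨hd, hZ⟩, map_zero]
  · exact indicator_of_notMem hd _

/-- At points of the domain, the domain is a neighbourhood within the epigraph. Every other point
has a neighbourhood missing the compact support, so extension by zero is harmless. -/
theorem contDiffOn_flux (hS : IsCompact S) (hZ : IsClosed Z) (hZS : S ∩ Z ⊆ c.patch)
    (hΦ : ContDiffOn ℝ 1 (Φ ∘ c.map) c.dom) (h0 : ∀ y ∈ S, y ∉ Z → Φ y = 0)
    (op : E3 →L[ℝ] V →L[ℝ] W) (l : Fin 2) : ContDiffOn ℝ 1 (c.flux op Φ l) (epi c.h) := by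
  intro x hx
  by_cases hd : x ∈ c.dom
  · have h1 : ContDiffWithinAt ℝ 1 (fun x => op (c.conormal l x) ((Φ ∘ c.map) x)) c.dom x :=
      (op.contDiff.contDiffAt.comp_contDiffWithinAt x
        (c.contDiffAt_conormal l hd).contDiffWithinAt).clm_apply (hΦ x hd)
    exact (h1.congr (fun z hz => c.flux_of_mem op l hz) (c.flux_of_mem op l hd)).mono_of_mem_nhdsWithin
      (c.dom_mem_nhdsWithin_epi hd)
  · have hK := (c.isCompact_dom_inter_preimage hS hZ hZS).isClosed.isOpen_compl
    have hxK : x ∈ (c.dom ∩ c.map ⁻¹' Z)ᶜ := fun h => hd h.1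
    refine (contDiffWithinAt_const (c := (0 : W))).congr_of_eventuallyEq ?_
      (c.flux_eq_zero op l h0 hxK)
    filter_upwards [mem_nhdsWithin_of_mem_nhds (hK.mem_nhds hxK)] with z hz
    exact c.flux_eq_zero op l h0 hz

theorem fderivWithin_flux (hΦ : ContDiffOn ℝ 1 (Φ ∘ c.map) c.dom) (op : E3 →L[ℝ] V →L[ℝ] W)
    (l : Fin 2) {x : ℝ × ℝ} (hx : x ∈ c.dom) (v : ℝ × ℝ) :
    fderivWithin ℝ (c.flux op Φ l) (epi c.h) x v =
      op (fderiv ℝ (c.conormal l) x v) (Φ (c.map x)) +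
        op (c.conormal l x) (fderivWithin ℝ (Φ ∘ c.map) c.dom x v) := by
  obtain ⟨K, hK⟩ := c.lipschitz_h
  have h1 := ((c.contDiffAt_conormal l hx).differentiableAt one_ne_zero).hasFDerivAt
  have h2 := ((hΦ.differentiableOn one_ne_zero) x hx).hasFDerivWithinAt
  have h3 := (op.hasFDerivAt.comp_hasFDerivWithinAt x h1.hasFDerivWithinAt).clm_apply h2
  have h4 : HasFDerivWithinAt (c.flux op Φ l) _ c.dom x :=
    h3.congr (fun z hz => c.flux_of_mem op l hz) (c.flux_of_mem op l hx)
  rw [(h4.mono_of_mem_nhdsWithin (c.dom_mem_nhdsWithin_epi hx)).fderivWithin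
    (uniqueDiffOn_epi hK x hx.2)]
  simp [add_comm]

/-- Product rule: derivatives falling on the conormal fields produce the curvature term, those
falling on the field produce the surface gradient. -/
theorem divergence_flux (hn : IsUnitNormal S n) (hΦ : ContDiffOn ℝ 1 (Φ ∘ c.map) c.dom)
    (op : E3 →L[ℝ] V →L[ℝ] W) {x : ℝ × ℝ} (hx : x ∈ c.dom) :
    fderivWithin ℝ (c.flux op Φ 0) (epi c.h) x (1, 0) +
      fderivWithin ℝ (c.flux op Φ 1) (epi c.h) x (0, 1) =
    Real.sqrt (c.metric x).det • (contraction op Φ c x +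
      meanCurvature S n (c.map x) • op (n (c.map x)) (Φ (c.map x))) := by
  rw [c.fderivWithin_flux hΦ op 0 hx, c.fderivWithin_flux hΦ op 1 hx, c.meanCurvature_map hn hx]
  have hdiv := c.divergence_conormal hn hx
  have h0 : coordDir 0 = (1, 0) := rfl
  have h1 : coordDir 1 = (0, 1) := rfl
  rw [h0, h1] at hdiv
  have e : op (fderiv ℝ (c.conormal 0) x (1, 0)) (Φ (c.map x)) +
      op (fderiv ℝ (c.conormal 1) x (0, 1)) (Φ (c.map x)) =
      Real.sqrt (c.metric x).det • c.meanCurv n x • op (n (c.map x)) (Φ (c.map x)) := by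
    rw [← add_apply, ← map_add, hdiv]
    simp
  rw [smul_add, ← e, contraction, Fin.sum_univ_two, smul_add, h0, h1, c.conormal_eq hx 0,
    c.conormal_eq hx 1]
  simp only [map_smul, smul_apply]
  abel

/-- The surface divergence formula in a chart, for a field that is supported in the chart. -/
theorem stokes_coordinates [CompleteSpace W] (hS : IsCompact S) (hn : IsUnitNormal S n)
    {τ : E3 → E3} (hτ : IsPositiveTangent S n τ) (hZ : IsClosed Z) (hZS : S ∩ Z ⊆ c.patch)
    (hΦ : ContDiffOn ℝ 1 (Φ ∘ c.map) c.dom) (h0 : ∀ y ∈ S, y ∉ Z → Φ y = 0)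
    (op : E3 →L[ℝ] V →L[ℝ] W) :
    IntegrableOn (fun s => ‖deriv c.edge s‖ •
      op (cross (τ (c.edge s)) (n (c.edge s))) (Φ (c.edge s))) c.edgeDom ∧
    IntegrableOn (fun x => Real.sqrt (c.metric x).det • (contraction op Φ c x +
      meanCurvature S n (c.map x) • op (n (c.map x)) (Φ (c.map x)))) c.dom ∧
    ∫ s in c.edgeDom, ‖deriv c.edge s‖ •
      op (cross (τ (c.edge s)) (n (c.edge s))) (Φ (c.edge s)) =
    ∫ x in c.dom, Real.sqrt (c.metric x).det • (contraction op Φ c x +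
      meanCurvature S n (c.map x) • op (n (c.map x)) (Φ (c.map x))) := by
  obtain ⟨K, hK⟩ := c.lipschitz_h
  have hKc := c.isCompact_dom_inter_preimage hS hZ hZS
  have hz : ∀ l, ∀ x ∈ epi c.h, x ∉ c.dom ∩ c.map ⁻¹' Z → c.flux op Φ l x = 0 :=
    fun l x _ hx => c.flux_eq_zero op l h0 hx
  have hC := fun l => c.contDiffOn_flux hS hZ hZS hΦ h0 op l
  obtain ⟨i1, i2, heq⟩ := integral_epi_divergence hK c.corners.countable_toSet
    (fun s hs => (c.hasDerivAt_h hs).differentiableAt) (hC 0) (hC 1) hKc (hz 0) (hz 1)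
  have hsub : c.dom ⊆ epi c.h := fun x hx => hx.2
  have hdom : ∀ x ∈ c.dom, _ = _ := fun x hx => c.divergence_flux hn hΦ op hx
  have hedge : ∀ s ∈ c.edgeDom, deriv c.h s • c.flux op Φ 0 (s, c.h s) - c.flux op Φ 1 (s, c.h s) =
      ‖deriv c.edge s‖ • op (cross (τ (c.edge s)) (n (c.edge s))) (Φ (c.edge s)) := by
    intro s hs
    have hx := c.edge_mem_dom hs.1
    have e := congrArg (fun v => op v (Φ (c.edge s))) (c.norm_smul_cross_tangent hn hτ hs)
    simp only [map_sub, map_smul, sub_apply,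
      smul_apply] at e
    rw [e, c.flux_of_mem op 0 hx, c.flux_of_mem op 1 hx]
    rfl
  refine ⟨?_, ?_, ?_⟩
  · exact (i2.integrableOn (s := c.edgeDom)).congr_fun hedge c.isOpen_edgeDom.measurableSet
  · exact (i1.mono_set hsub).congr_fun hdom c.measurableSet_dom
  · rw [← setIntegral_congr_fun c.measurableSet_dom hdom,
      ← setIntegral_congr_fun c.isOpen_edgeDom.measurableSet hedge,
      ← setIntegral_eq_of_subset_of_forall_sdiff_eq_zero
        (isClosed_epi hK.continuous).measurableSet hsub, heq]
    -- Corners are negligible, and at other parameters outside `edgeDom` the graph point lies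
    -- outside the domain, where the fluxes vanish.
    · refine setIntegral_eq_integral_of_ae_compl_eq_zero ?_
      filter_upwards [compl_mem_ae_iff.2 (c.corners.finite_toSet.measure_zero volume)]
        with s hs hs'
      have hns : (s, c.h s) ∉ c.dom := fun hd => hs' ⟨hd.1, hs⟩
      have := fun l => c.flux_eq_zero (Z := Z) op (Φ := Φ) l h0 (x := (s, c.h s))
        fun h => hns h.1
      rw [this, this, smul_zero, sub_zero]
    · intro x hx
      have hxK : x ∉ c.dom ∩ c.map ⁻¹' Z := fun h => hx.2 h.1
      rw [fderivWithin_epi_eq_zero hKc (hz 0) hx.1 hxK, fderivWithin_epi_eq_zero hKc (hz 1) hx.1 hxK]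
      simp

theorem contraction_eq_zero (hZ : IsClosed Z) (h0 : ∀ y ∈ S, y ∉ Z → Φ y = 0)
    (op : E3 →L[ℝ] V →L[ℝ] W) {x : ℝ × ℝ} (hx : x ∈ c.dom) (hxZ : c.map x ∉ Z) :
    contraction op Φ c x = 0 := by
  have heq : Φ ∘ c.map =ᶠ[𝓝[c.dom] x] fun _ => 0 := by
    filter_upwards [self_mem_nhdsWithin,
      c.continuousOn_map x hx (hZ.isOpen_compl.mem_nhds hxZ)] with z hz hz'
    exact h0 _ (c.map_mem hz) hz'
  rw [contraction]
  refine Finset.sum_eq_zero fun l _ => ?_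
  rw [heq.fderivWithin_eq (h0 _ (c.map_mem hx) hxZ)]
  simp

end LocalParam

/-! ### From charts to the whole surface. -/

section Global

open Set Filter Topology

variable {S : Set E3} {V W : Type*} [NormedAddCommGroup V] [NormedSpace ℝ V]
  [NormedAddCommGroup W] [NormedSpace ℝ W]

/-- The contraction `g^l ∘ ∂Φ/∂x^l` as a field on the surface. -/
noncomputable def surfaceContraction (S : Set E3) (op : E3 →L[ℝ] V →L[ℝ] W) (Φ : E3 → V) :
    E3 → W := atPoint S fun c x => LocalParam.contraction op Φ c x

theorem surfaceContraction_map {Φ : E3 → V} (hΦ : ∀ c : LocalParam S, ContDiffOn ℝ 1 (Φ ∘ c.map) c.dom)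
    (op : E3 →L[ℝ] V →L[ℝ] W) (c : LocalParam S) {x : ℝ × ℝ} (hx : x ∈ c.dom) :
    surfaceContraction S op Φ (c.map x) = LocalParam.contraction op Φ c x :=
  LocalParam.atPoint_eq (F := fun c x => LocalParam.contraction op Φ c x)
    (fun _ c' _ hx _ hx' h => LocalParam.contraction_eq_of_map_eq op hx hx' h
      (((hΦ c').differentiableOn one_ne_zero) _ hx')) c hx

/-- The Stokes formula for a field that is supported in a chart. -/
theorem stokes_of_support_subset_patch [CompleteSpace W] (hS : IsCompactSurface S) {n τ : E3 → E3}
    (hn : IsUnitNormal S n) (hτ : IsPositiveTangent S n τ) {Φ : E3 → V}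
    (hΦ : ∀ c : LocalParam S, ContDiffOn ℝ 1 (Φ ∘ c.map) c.dom) (op : E3 →L[ℝ] V →L[ℝ] W) (c : LocalParam S) {Z : Set E3}
    (hZ : IsClosed Z) (hZS : S ∩ Z ⊆ c.patch) (h0 : ∀ y ∈ S, y ∉ Z → Φ y = 0) :
    Integrable (fun y => op (cross (τ y) (n y)) (Φ y)) (boundaryMeasure S) ∧
      Integrable (fun y => surfaceContraction S op Φ y + meanCurvature S n y • op (n y) (Φ y))
        (areaMeasure S) ∧
      ∫ y, op (cross (τ y) (n y)) (Φ y) ∂(boundaryMeasure S) =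
        ∫ y, (surfaceContraction S op Φ y + meanCurvature S n y • op (n y) (Φ y))
          ∂(areaMeasure S) := by
  obtain ⟨i1, i2, heq⟩ := c.stokes_coordinates hS.1 hn hτ hZ hZS (hΦ c) h0 op
  have hSm := hS.1.measurableSet
  have hnotZ : ∀ y ∈ S, y ∉ c.patch → y ∉ Z := fun y hy hyp hyZ => hyp (hZS ⟨hy, hyZ⟩)
  -- Both measures are carried by `S`, and off the patch both integrands vanish there, so each
  -- global integral reduces to the patch, where the measure is the chart's own element.
  have hb : ∀ᵐ y ∂(boundaryMeasure S), y ∉ c.patch → op (cross (τ y) (n y)) (Φ y) = 0 := by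
    have : ∀ᵐ y ∂(boundaryMeasure S), y ∈ S := boundaryMeasure_compl hSm
    filter_upwards [this] with y hy hyp
    rw [h0 y hy (hnotZ y hy hyp), map_zero]
  have ha : ∀ᵐ y ∂(areaMeasure S), y ∉ c.patch →
      surfaceContraction S op Φ y + meanCurvature S n y • op (n y) (Φ y) = 0 := by
    have : ∀ᵐ y ∂(areaMeasure S), y ∈ S := areaMeasure_compl hSm
    filter_upwards [this] with y hy hyp
    have hyZ := hnotZ y hy hyp
    obtain ⟨c', x, hx, rfl⟩ := hS.2 y hy
    rw [surfaceContraction_map hΦ op c' hx, c'.contraction_eq_zero hZ h0 op hx hyZ, h0 _ hy hyZ,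
      map_zero, smul_zero, add_zero]
  have hρ0 : ∀ x ∈ c.dom, 0 ≤ Real.sqrt (c.metric x).det := fun x _ => Real.sqrt_nonneg _
  have hρ0' : ∀ s ∈ c.edgeDom, 0 ≤ ‖deriv c.edge s‖ := fun s _ => norm_nonneg _
  have hinj := c.injOn_edge.mono c.edgeDom_subset
  have hem := c.isOpen_edgeDom.measurableSet
  have hcongr : ∀ x ∈ c.dom, Real.sqrt (c.metric x).det • (LocalParam.contraction op Φ c x +
      meanCurvature S n (c.map x) • op (n (c.map x)) (Φ (c.map x))) =
      Real.sqrt (c.metric x).det • (surfaceContraction S op Φ (c.map x) +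
      meanCurvature S n (c.map x) • op (n (c.map x)) (Φ (c.map x))) := fun x hx => by
    rw [surfaceContraction_map hΦ op c hx]
  refine ⟨?_, ?_, ?_⟩
  · refine IntegrableOn.integrable_of_ae_notMem_eq_zero (s := c.patch) ?_ hb
    rw [IntegrableOn, c.boundaryMeasure_restrict_patch]
    exact (integrable_map_withDensity_iff hem c.continuousOn_edge hinj
      c.continuousOn_deriv_edge.norm hρ0').2 i1
  · refine IntegrableOn.integrable_of_ae_notMem_eq_zero (s := c.patch) ?_ ha
    rw [IntegrableOn, c.areaMeasure_restrict_patch]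
    exact (integrable_map_withDensity_iff c.measurableSet_dom c.continuousOn_map c.injOn_map
      c.continuousOn_sqrt_det_metric hρ0).2 (i2.congr_fun hcongr c.measurableSet_dom)
  · rw [← setIntegral_eq_integral_of_ae_compl_eq_zero hb,
      ← setIntegral_eq_integral_of_ae_compl_eq_zero ha, c.boundaryMeasure_restrict_patch,
      c.areaMeasure_restrict_patch]
    have e1 := integral_map_withDensity (μ := volume) hem c.continuousOn_edge hinj
      c.continuousOn_deriv_edge.norm hρ0' (F := fun y => op (cross (τ y) (n y)) (Φ y))
    have e2 := integral_map_withDensity (μ := volume) c.measurableSet_dom c.continuousOn_map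
      c.injOn_map c.continuousOn_sqrt_det_metric hρ0
      (F := fun y => surfaceContraction S op Φ y + meanCurvature S n y • op (n y) (Φ y))
    rw [← setIntegral_congr_fun c.measurableSet_dom hcongr] at e2
    exact e1.trans (heq.trans e2.symm)

theorem contDiffOn_smul_field {Φ : E3 → V} (hΦ : ∀ c : LocalParam S, ContDiffOn ℝ 1 (Φ ∘ c.map) c.dom) {χ : E3 → ℝ}
    (hχ : ContDiff ℝ 1 χ) : ∀ c : LocalParam S, ContDiffOn ℝ 1 ((fun y => χ y • Φ y) ∘ c.map) c.dom := fun c =>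
  (hχ.comp_contDiffOn ((c.contDiffOn_map.of_le one_le_two).mono c.dom_subset)).smul (hΦ c)

/-- A finite smooth partition of unity that is subordinate to the patches of a compact surface. -/
theorem exists_partition (hS : IsCompactSurface S) :
    ∃ (ι : Type) (_ : Fintype ι) (χ : ι → E3 → ℝ) (c : ι → LocalParam S),
      (∀ i, ContDiff ℝ 1 (χ i)) ∧ (∀ i, S ∩ tsupport (χ i) ⊆ (c i).patch) ∧
      ∀ y ∈ S, ∑ i, χ i y = 1 := by
  have hex : ∀ y : S, ∃ (c : LocalParam S) (O : Set E3), IsOpen O ∧ c.patch = S ∩ O ∧ y.1 ∈ O := by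
    intro y
    obtain ⟨c, x, hx, hxy⟩ := hS.2 y.1 y.2
    obtain ⟨O, hO, hcO⟩ := c.image_open
    have h : c.patch = S ∩ O := hcO
    exact ⟨c, O, hO, h, (h.subset ⟨x, hx, hxy⟩).2⟩
  choose c O hO hcO hyO using hex
  obtain ⟨t, ht⟩ := hS.1.elim_finite_subcover O hO fun y hy =>
    mem_iUnion.2 ⟨⟨y, hy⟩, hyO ⟨y, hy⟩⟩
  let e := t.equivFin.symm
  obtain ⟨f, hf⟩ := SmoothPartitionOfUnity.exists_isSubordinate (modelWithCornersSelf ℝ E3)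
    hS.1.isClosed (fun i : Fin t.card => O (e i)) (fun i => hO _) (by
      intro y hy
      obtain ⟨z, hz⟩ := mem_iUnion.1 (ht hy)
      obtain ⟨hzt, hyz⟩ := mem_iUnion.1 hz
      exact mem_iUnion.2 ⟨e.symm ⟨z, hzt⟩, by simpa using hyz⟩)
  refine ⟨Fin t.card, inferInstance, fun i => f i, fun i => c (e i), fun i => ?_, fun i => ?_, ?_⟩
  · exact (f i).contMDiff.contDiff.of_le (by simp)
  · rw [hcO]
    exact inter_subset_inter_right _ (hf i)
  · intro y hy
    rw [← finsum_eq_sum_of_fintype]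
    exact f.sum_eq_one hy

theorem surfaceContraction_sum (hS : IsCompactSurface S) {ι : Type} [Fintype ι]
    {Φ : E3 → V} {Ψ : ι → E3 → V} (hΦ : ∀ c : LocalParam S, ContDiffOn ℝ 1 (Φ ∘ c.map) c.dom) (hΨ : ∀ i, ∀ c : LocalParam S, ContDiffOn ℝ 1 (Ψ i ∘ c.map) c.dom)
    (hsum : ∀ y ∈ S, Φ y = ∑ i, Ψ i y) (op : E3 →L[ℝ] V →L[ℝ] W)
    {y : E3} (hy : y ∈ S) :
    surfaceContraction S op Φ y = ∑ i, surfaceContraction S op (Ψ i) y := by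
  obtain ⟨c, x, hx, rfl⟩ := hS.2 y hy
  rw [surfaceContraction_map hΦ op c hx]
  simp_rw [surfaceContraction_map (hΨ _) op c hx]
  have h1 : HasFDerivWithinAt (Φ ∘ c.map)
      (∑ i, fderivWithin ℝ (Ψ i ∘ c.map) c.dom x) c.dom x := by
    have h2 : HasFDerivWithinAt (fun z => ∑ i, (Ψ i ∘ c.map) z)
        (∑ i, fderivWithin ℝ (Ψ i ∘ c.map) c.dom x) c.dom x :=
      HasFDerivWithinAt.fun_sum fun i _ =>
        (((hΨ i c).differentiableOn one_ne_zero) x hx).hasFDerivWithinAt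
    exact h2.congr (fun z hz => hsum _ (c.map_mem hz)) (hsum _ hy)
  simp only [LocalParam.contraction]
  rw [h1.fderivWithin (c.uniqueDiffOn_dom x hx), Finset.sum_comm]
  simp

/-- The generalized Stokes formula with the gradient acting from the left. -/
theorem stokes_contraction [CompleteSpace W] (hS : IsCompactSurface S) {n τ : E3 → E3}
    (hn : IsUnitNormal S n) (hτ : IsPositiveTangent S n τ) {Φ : E3 → V}
    (hΦ : ∀ c : LocalParam S, ContDiffOn ℝ 1 (Φ ∘ c.map) c.dom) (op : E3 →L[ℝ] V →L[ℝ] W) :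
    Integrable (fun y => op (cross (τ y) (n y)) (Φ y)) (boundaryMeasure S) ∧
      Integrable (fun y => surfaceContraction S op Φ y + meanCurvature S n y • op (n y) (Φ y))
        (areaMeasure S) ∧
      ∫ y, op (cross (τ y) (n y)) (Φ y) ∂(boundaryMeasure S) =
        ∫ y, (surfaceContraction S op Φ y + meanCurvature S n y • op (n y) (Φ y))
          ∂(areaMeasure S) := by
  obtain ⟨ι, _, χ, c, hχ, hsupp, hone⟩ := exists_partition hS
  have hΨ := fun i => contDiffOn_smul_field hΦ (hχ i)
  have hsum : ∀ y ∈ S, Φ y = ∑ i, χ i y • Φ y := fun y hy => by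
    rw [← Finset.sum_smul, hone y hy, one_smul]
  have key := fun i => stokes_of_support_subset_patch hS hn hτ (hΨ i) op (c i)
    (isClosed_tsupport (χ i)) (hsupp i) fun y _ hy => by
      rw [image_eq_zero_of_notMem_tsupport hy, zero_smul]
  have hb : (fun y => op (cross (τ y) (n y)) (Φ y)) =ᵐ[boundaryMeasure S]
      fun y => ∑ i, op (cross (τ y) (n y)) (χ i y • Φ y) := by
    have : ∀ᵐ y ∂(boundaryMeasure S), y ∈ S := boundaryMeasure_compl hS.1.measurableSet
    filter_upwards [this] with y hy
    rw [← map_sum, ← hsum y hy]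
  have ha : (fun y => surfaceContraction S op Φ y + meanCurvature S n y • op (n y) (Φ y))
      =ᵐ[areaMeasure S] fun y => ∑ i, (surfaceContraction S op (fun y => χ i y • Φ y) y +
        meanCurvature S n y • op (n y) (χ i y • Φ y)) := by
    have : ∀ᵐ y ∂(areaMeasure S), y ∈ S := areaMeasure_compl hS.1.measurableSet
    filter_upwards [this] with y hy
    rw [Finset.sum_add_distrib, ← Finset.smul_sum, ← map_sum, ← hsum y hy,
      surfaceContraction_sum hS hΦ hΨ hsum op hy]
  refine ⟨(integrable_congr hb).2 (integrable_finsetSum _ fun i _ => (key i).1),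
    (integrable_congr ha).2 (integrable_finsetSum _ fun i _ => (key i).2.1), ?_⟩
  rw [integral_congr_ae hb, integral_congr_ae ha, integral_finsetSum _ fun i _ => (key i).1,
    integral_finsetSum _ fun i _ => (key i).2.1]
  exact Finset.sum_congr rfl fun i _ => (key i).2.2

end Global

theorem proposition2 (S : Set E3) (hS : IsCompactSurface S) (n τ : E3 → E3)
    (hn : IsUnitNormal S n) (hτ : IsPositiveTangent S n τ)
    (p q : ℕ) (Φ : E3 → Tensor p) (hΦ : IsC1Field S Φ) :
    (∀ op : E3 →L[ℝ] Tensor p →L[ℝ] Tensor q,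
      Integrable (fun y => op (cross (τ y) (n y)) (Φ y)) (boundaryMeasure S) ∧
      Integrable (fun y => surfaceGradLeft S op Φ y + meanCurvature S n y • op (n y) (Φ y))
        (areaMeasure S) ∧
      ∫ y, op (cross (τ y) (n y)) (Φ y) ∂(boundaryMeasure S) =
        ∫ y, (surfaceGradLeft S op Φ y + meanCurvature S n y • op (n y) (Φ y))
          ∂(areaMeasure S)) ∧
    (∀ op : Tensor p →L[ℝ] E3 →L[ℝ] Tensor q,
      Integrable (fun y => op (Φ y) (cross (τ y) (n y))) (boundaryMeasure S) ∧
      Integrable (fun y => surfaceGradRight S op Φ y + meanCurvature S n y • op (Φ y) (n y))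
        (areaMeasure S) ∧
      ∫ y, op (Φ y) (cross (τ y) (n y)) ∂(boundaryMeasure S) =
        ∫ y, (surfaceGradRight S op Φ y + meanCurvature S n y • op (Φ y) (n y))
          ∂(areaMeasure S)) := by
  -- Both surface gradients unfold to `surfaceContraction`, the right one with the arguments of the
  -- operation exchanged.
  exact ⟨stokes_contraction hS hn hτ hΦ, fun op => stokes_contraction hS hn hτ hΦ op.flip⟩
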